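/- Let $K$ be a field and $E$ a directed graph with vertex set $E^0$, edge set $E^1$, source and range maps $\mathbf s,\mathbf r$ (no finiteness is assumed, and vertices may emit infinitely many edges). A *sink* is a vertex that emits no edges, an *infinite emitter* is a vertex that emits infinitely many edges, and a vertex that is neither is *regular*. Let $L_K(E)$ be the Leavitt path algebra of $E$: the (in general non-unital) associative $K$-algebra generated by $E^0\cup E^1\cup\{e^*\mid e\in E^1\}$ with relations $vw=\delta_{v,w}v$, $\mathbf s(e)e=e=e\mathbf r(e)$, $\mathbf r(e)e^*=e^*=e^*\mathbf s(e)$, $e^*f=\delta_{e,f}\mathbf r(e)$, and $v=\sum_{\mathbf s(e)=v}ee^*$ for every regular vertex $v$. It is $\mathbb Z$-graded by letting $L_K(E)_n$ be the span of the $pq^*$ for paths $p,q$ with $\mathbf r(p)=\mathbf r(q)$ and $|p|-|q|=n$. Modules are left modules, and $M(k)$ denotes the shift $M(k)_n=M_{n+k}$. A *cycle* is a closed path of positive length whose edges have pairwise different sources; cycles that differ only by the choice of the base vertex are identified. A cycle $c$ is *exclusive* if no vertex of $c$ lies on a cycle different from $c$. Write $c^0$ for the set of vertices of $c$, and $R(W)$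 for the set of vertices from which there is a path to some vertex of $W\subseteq E^0$. *Branching systems.* A branching system of $E$ is a set $X$ with pairwise disjoint subsets $X_w$ ($w\in E^0$), pairwise disjoint subsets $X_e\subseteq X_{\mathbf s(e)}$ ($e\in E^1$) and bijections $\sigma_e:X_{\mathbf r(e)}\to X_e$ such that $X_w=\bigcup_{\mathbf s(e)=w}X_e$ for every regular $w$. Its $L_K(E)$-module $M(X)$ is the $K$-vector space with basis $X$ on which $w\cdot x=x$ if $x\in X_w$, $e\cdot x=\sigma_e(x)$ if $x\in X_{\mathbf r(e)}$, $e^*\cdot x=\sigma_e^{-1}(x)$ if $x\in X_e$, and these products are $0$ otherwise. *The module $\mathbf N_c^v$.* Let $c$ be an exclusive cycle and $v\in c^0$. Let $Y^v$ be the set of formal elements $pq^*$ where $p,q$ are paths with $\mathbf r(p)=\mathbf r(q)\in c^0$ and $\mathbf s(q)=v$. Let $\operatorname{red}:Y^v\to Y^v$ be the map that removes the common final edges of $p$ and $q$ one after another, i.e. $\operatorname{red}(pee^*q^*)=\operatorname{red}(pq^*)$, and $\operatorname{red}(pq^*)=pq^*$ if $p$ and $q$ do not end with the same edge. Let $X^v$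 be the set of $x\in Y^v$ with $\operatorname{red}(x)=x$. With $X^v_w=\{pq^*\in X^v\mid \mathbf s(p)=w\}$, $X^v_e=\{x\in X^v\mid x=\operatorname{red}(ers^*)\text{ for some }ers^*\in Y^v\}$ and $\sigma_e(pq^*)=\operatorname{red}(epq^*)$, $X^v$ is a branching system. Put $\mathbf N^v_c=M(X^v)$, and let $(\mathbf N^v_c)_n$ be the span of the $pq^*\in X^v$ with $|p|-|q|=n$. *Chen modules.* These are the following modules. (i) $\mathbf V_{[\alpha]}=M(X)$ for an infinite path $\alpha$, where $X$ is the set of infinite paths tail equivalent to $\alpha$, $X_w$ and $X_e$ consist of those with source $w$, respectively with first edge $e$, and $\sigma_e(\beta)=e\beta$. (ii) $\mathbf V^f_{[\alpha]}$ for an infinite path $\alpha$ tail equivalent to $ddd\ldots$ for a cycle $d$ and an irreducible $f\in K[x,x^{-1}]$: with $K'=K[x,x^{-1}]/(f)$, it is the $L_{K'}(E)$-module $\mathbf V_{[\alpha]}$ twisted by the automorphism of $L_{K'}(E)$ that multiplies the first edge $e_1$ of $d$ by the class of $x$ and $e_1^*$ by its inverse, and fixes all other generators, regarded as an $L_K(E)$-module.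 (iii) $\mathbf N_u=M(X)$ for a vertex $u$ which is a sink or an infinite emitter, where $X$ is the set of paths ending at $u$, $X_w$ and $X_e$ consist of those with source $w$, respectively with first edge $e$, and $\sigma_e(p)=ep$. For $H\subseteq E^0$ let $B_H$ be the set of infinite emitters $w\notin H$ for which $\{e\mid \mathbf s(e)=w,\ \mathbf r(e)\notin H\}$ is nonempty and finite; for $w\in B_H$ let $w^H=w-\sum ee^*$, the sum over this set. For $S\subseteq B_H$ let $I(H,S)$ be the ideal of $L_K(E)$ generated by $H\cup\{w^H\mid w\in S\}$. **Proposition.** Let $c$ be an exclusive cycle of $E$, let $v\in c^0$, and let $H=E^0-R(c^0)$. 1. $\operatorname{ann}(\mathbf N^v_c)=I(H,B_H)$. 2. $\mathbf N^v_c$ is a graded module; it is graded simple and not simple. 3. If $w\in c^0$ and there is a path of length $n$ from $v$ to $w$ all of whose edges are edges of $c$, then $\mathbf N^v_c$ and $\mathbf N^w_c(n)$ are graded isomorphic. (In particular, if $w\ne v$, this holds for the length $n$ of the path from $v$ to $w$ in $c$.) 4. If $d$ is an exclusive cycle and $w\in d^0$, then $\mathbf N^v_c$ and $\mathbf N^w_d$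 are graded isomorphic if and only if $c=d$ and $v=w$, and they are isomorphic if and only if $c=d$. 5. $\mathbf N^v_c$ is not isomorphic to any of the Chen modules. Moreover, the annihilator of $\mathbf N^v_c$ is different from the annihilator of every Chen module. -/

import Mathlib

/-- A directed graph with vertex set `V`, edge set `E`, source map `s` and range map `r`;
loops and parallel edges are allowed, and there is no finiteness assumption. -/
structure DirGraph (V : Type*) (E : Type*) where
  s : E → V
  r : E → V

namespace DirGraph

variable {V E : Type*} (G : DirGraph V E)

/-- `G.IsPath u l w`: the list of edges `l` is a path from `u` to `w`; the empty list is the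
trivial path at `u = w`. -/
def IsPath : V → List E → V → Prop
  | u, [], w => u = w
  | u, e :: l, w => G.s e = u ∧ IsPath (G.r e) l w

def IsSink (v : V) : Prop := ∀ e, G.s e ≠ v

def IsInfiniteEmitter (v : V) : Prop := {e | G.s e = v}.Infinite

def IsRegular (v : V) : Prop := ¬ G.IsSink v ∧ ¬ G.IsInfiniteEmitter v

/-- The root `R(W)` of `W`: all vertices from which some vertex of `W` can be reached. -/
def root (W : Set V) : Set V := {u | ∃ w ∈ W, ∃ l, G.IsPath u l w}

/-- A cycle, written as the list of its edges from some base vertex: a closed path of positive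
length whose edges have pairwise different sources. Two such lists represent the same cycle if and
only if one is a rotation of the other. -/
def IsCycle (c : List E) : Prop :=
  c ≠ [] ∧ (∃ v, G.IsPath v c v) ∧ (c.map G.s).Nodup

/-- The set of vertices of a cycle. -/
def cycleVerts (c : List E) : Set V := {v | ∃ e ∈ c, G.s e = v}

/-- A cycle is exclusive if none of its vertices is on a cycle different from it. -/
def IsExclusive (c : List E) : Prop :=
  G.IsCycle c ∧ ∀ d, G.IsCycle d → (∃ v ∈ G.cycleVerts c, v ∈ G.cycleVerts d) → c ~r d

/-- The breaking vertices `B_H` of a set `H` of vertices. -/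
def breaking (H : Set V) : Set V :=
  {v | G.IsInfiniteEmitter v ∧ v ∉ H ∧
    {e | G.s e = v ∧ G.r e ∉ H}.Nonempty ∧ {e | G.s e = v ∧ G.r e ∉ H}.Finite}

end DirGraph

/-! ### Leavitt path algebras -/

/-- Generators: vertices, edges and ghost edges. -/
inductive LeavittGen (V : Type*) (E : Type*)
  | vert (v : V)
  | edge (e : E)
  | ghost (e : E)

/-- The free associative non-unital algebra on the generators. -/
abbrev LeavittFree (K V E : Type*) [Field K] : Type _ :=
  MonoidAlgebra K (FreeSemigroup (LeavittGen V E))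

namespace LeavittFree

variable (K : Type*) {V E : Type*} [Field K]

noncomputable def gen (g : LeavittGen V E) : LeavittFree K V E :=
  MonoidAlgebra.single (FreeSemigroup.of g) 1

noncomputable abbrev vert (v : V) : LeavittFree K V E := gen K (.vert v)
noncomputable abbrev edge (e : E) : LeavittFree K V E := gen K (.edge e)
noncomputable abbrev ghost (e : E) : LeavittFree K V E := gen K (.ghost e)

end LeavittFree

open LeavittFree in
/-- The defining relations of the Leavitt path algebra. The last constructor closes them under
scalars, so that the ring congruence generated by them is compatible with scalars. -/
inductive LeavittRel (K : Type*) {V E : Type*} [Field K] (G : DirGraph V E) :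
    LeavittFree K V E → LeavittFree K V E → Prop
  | vert_mul_self (v : V) : LeavittRel K G (vert K v * vert K v) (vert K v)
  | vert_mul_ne (v w : V) (h : v ≠ w) : LeavittRel K G (vert K v * vert K w) 0
  | s_mul_edge (e : E) : LeavittRel K G (vert K (G.s e) * edge K e) (edge K e)
  | edge_mul_r (e : E) : LeavittRel K G (edge K e * vert K (G.r e)) (edge K e)
  | r_mul_ghost (e : E) : LeavittRel K G (vert K (G.r e) * ghost K e) (ghost K e)
  | ghost_mul_s (e : E) : LeavittRel K G (ghost K e * vert K (G.s e)) (ghost K e)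
  | ck1_self (e : E) : LeavittRel K G (ghost K e * edge K e) (vert K (G.r e))
  | ck1_ne (e f : E) (h : e ≠ f) : LeavittRel K G (ghost K e * edge K f) 0
  | ck2 (v : V) (hv : G.IsRegular v) :
      LeavittRel K G (vert K v)
        (∑ e ∈ (Set.not_infinite.mp hv.2).toFinset, edge K e * ghost K e)
  | smul (k : K) (a b : LeavittFree K V E) : LeavittRel K G a b → LeavittRel K G (k • a) (k • b)

/-- The congruence generated by the defining relations. -/
noncomputable def leavittCon (K : Type*) {V E : Type*} [Field K] (G : DirGraph V E) :
    RingCon (LeavittFree K V E) :=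
  ringConGen (LeavittRel K G)

theorem leavittCon_smul {K : Type*} {V E : Type*} [Field K] (G : DirGraph V E) (k : K)
    {a b : LeavittFree K V E} (h : leavittCon K G a b) : leavittCon K G (k • a) (k • b) := by
  change RingConGen.Rel _ _ _ at h
  change RingConGen.Rel _ _ _
  induction h with
  | of x y h => exact .of _ _ (.smul k _ _ h)
  | refl x => exact .refl _
  | symm _ ih => exact .symm ih
  | trans _ _ ih ih' => exact .trans ih ih'
  | add _ _ ih ih' => rw [smul_add, smul_add]; exact .add ih ih'
  | mul _ h' ih _ => rw [← smul_mul_assoc, ← smul_mul_assoc]; exact .mul ih h'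

/-- The Leavitt path algebra `L_K(E)` of the graph `G`; it is not unital in general. -/
def LPA (K : Type*) {V E : Type*} [Field K] (G : DirGraph V E) : Type _ :=
  (leavittCon K G).Quotient

namespace LPA

variable {K : Type*} {V E : Type*} [Field K] {G : DirGraph V E}

noncomputable instance : NonUnitalRing (LPA K G) :=
  inferInstanceAs (NonUnitalRing (leavittCon K G).Quotient)

variable (K G) in
noncomputable def mk : LeavittFree K V E →ₙ+* LPA K G where
  toFun a := ((a : (leavittCon K G).Quotient) : (leavittCon K G).Quotient)
  map_mul' _ _ := rfl
  map_zero' := rfl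
  map_add' _ _ := rfl

theorem mk_surjective : Function.Surjective (mk K G) := fun x => Quotient.inductionOn' x fun a => ⟨a, rfl⟩

noncomputable instance : SMul K (LPA K G) where
  smul k := Quotient.map' (fun a => k • a) fun _ _ h => leavittCon_smul G k h

theorem mk_smul (k : K) (a : LeavittFree K V E) : mk K G (k • a) = k • mk K G a := rfl

noncomputable instance : Module K (LPA K G) :=
  mk_surjective.module K (mk K G : LeavittFree K V E →+ LPA K G) mk_smul

instance : IsScalarTower K (LPA K G) (LPA K G) where
  smul_assoc k x y := by
    obtain ⟨a, rfl⟩ := mk_surjective x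
    obtain ⟨b, rfl⟩ := mk_surjective y
    simp only [smul_eq_mul, ← mk_smul, ← map_mul, smul_mul_assoc]

instance : SMulCommClass K (LPA K G) (LPA K G) where
  smul_comm k x y := by
    obtain ⟨a, rfl⟩ := mk_surjective x
    obtain ⟨b, rfl⟩ := mk_surjective y
    simp only [smul_eq_mul, ← mk_smul, ← map_mul, mul_smul_comm]

variable (K G)

noncomputable def vert (v : V) : LPA K G := mk K G (LeavittFree.vert K v)
noncomputable def edge (e : E) : LPA K G := mk K G (LeavittFree.edge K e)
noncomputable def ghost (e : E) : LPA K G := mk K G (LeavittFree.ghost K e)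

/-- The family `F` of elements of `A`, indexed by the generators, satisfies the defining
relations. -/
def Respects {A : Type*} [NonUnitalRing A] [Module K A] [IsScalarTower K A A]
    [SMulCommClass K A A] (F : LeavittGen V E → A) : Prop :=
  ∀ a b, LeavittRel K G a b →
    MonoidAlgebra.liftMagma K (FreeSemigroup.lift F) a =
      MonoidAlgebra.liftMagma K (FreeSemigroup.lift F) b

variable {K G}

/-- The universal property: a family of elements that satisfies the defining relations extends to
a homomorphism. -/
noncomputable def lift {A : Type*} [NonUnitalRing A] [Module K A] [IsScalarTower K A A]
    [SMulCommClass K A A] (F : LeavittGen V E → A)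
    (hF : Respects K G F) :
    LPA K G →ₙ+* A where
  toFun := Quotient.lift (MonoidAlgebra.liftMagma K (FreeSemigroup.lift F)) fun a b h => by
    change RingConGen.Rel _ _ _ at h
    induction h with
    | of x y h => exact hF _ _ h
    | refl x => rfl
    | symm _ ih => exact ih.symm
    | trans _ _ ih ih' => exact ih.trans ih'
    | add _ _ ih ih' => rw [map_add, map_add, ih, ih']
    | mul _ _ ih ih' => rw [map_mul, map_mul, ih, ih']
  map_mul' x y := by
    obtain ⟨a, rfl⟩ := mk_surjective x
    obtain ⟨b, rfl⟩ := mk_surjective y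
    exact map_mul (MonoidAlgebra.liftMagma K (FreeSemigroup.lift F)) a b
  map_zero' := map_zero (MonoidAlgebra.liftMagma K (FreeSemigroup.lift F))
  map_add' x y := by
    obtain ⟨a, rfl⟩ := mk_surjective x
    obtain ⟨b, rfl⟩ := mk_surjective y
    exact map_add (MonoidAlgebra.liftMagma K (FreeSemigroup.lift F)) a b

end LPA

/-! ### Branching systems and their modules -/

/-- A branching system of the graph `G` on a set `X`. -/
structure BranchingSystem {V E : Type*} (G : DirGraph V E) (X : Type*) where
  vset : V → Set X
  eset : E → Set X
  σ : ∀ e, vset (G.r e) → eset e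
  vset_disjoint : ∀ v w, v ≠ w → Disjoint (vset v) (vset w)
  eset_disjoint : ∀ e f, e ≠ f → Disjoint (eset e) (eset f)
  eset_subset : ∀ e, eset e ⊆ vset (G.s e)
  σ_bijective : ∀ e, Function.Bijective (σ e)
  cover : ∀ v, G.IsRegular v → vset v = ⋃ e ∈ {e | G.s e = v}, eset e

/-- A left module over a ring that need not be unital: an additive group together with a
(non-unital) ring homomorphism to its endomorphism ring. -/
abbrev LeftModule (R M : Type*) [NonUnitalRing R] [AddCommGroup M] : Type _ :=
  R →ₙ+* AddMonoid.End M

namespace BranchingSystem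

variable {V E X : Type*} {G : DirGraph V E} (B : BranchingSystem G X)
variable {A : Type*} [CommRing A] (wt : E → Aˣ)

noncomputable def σEquiv (e : E) : B.vset (G.r e) ≃ B.eset e :=
  Equiv.ofBijective (B.σ e) (B.σ_bijective e)

open Classical in
/-- The action of the generators on the free `A`-module with basis `X`, where an edge `e` acts
through `σ_e` multiplied by the unit `wt e`, and the ghost edge through the inverse. -/
noncomputable def genAction : LeavittGen V E → Module.End A (X →₀ A)
  | .vert v => Finsupp.linearCombination A fun x =>
      if x ∈ B.vset v then Finsupp.single x 1 else 0
  | .edge e => Finsupp.linearCombination A fun x =>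
      if h : x ∈ B.vset (G.r e) then Finsupp.single (B.σ e ⟨x, h⟩ : X) (wt e : A) else 0
  | .ghost e => Finsupp.linearCombination A fun x =>
      if h : x ∈ B.eset e then
        Finsupp.single ((B.σEquiv e).symm ⟨x, h⟩ : X) ((wt e)⁻¹ : Aˣ).val else 0

theorem genAction_vert_of_mem {v : V} {x : X} (h : x ∈ B.vset v) (a : A) :
    B.genAction wt (.vert v) (Finsupp.single x a) = Finsupp.single x a := by
  simp [genAction, h]

theorem genAction_vert_of_notMem {v : V} {x : X} (h : x ∉ B.vset v) (a : A) :
    B.genAction wt (.vert v) (Finsupp.single x a) = 0 := by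
  simp [genAction, h]

theorem genAction_edge_of_mem {e : E} {x : X} (h : x ∈ B.vset (G.r e)) (a : A) :
    B.genAction wt (.edge e) (Finsupp.single x a) =
      Finsupp.single (B.σ e ⟨x, h⟩ : X) (a * wt e) := by
  simp [genAction, h]

theorem genAction_edge_of_notMem {e : E} {x : X} (h : x ∉ B.vset (G.r e)) (a : A) :
    B.genAction wt (.edge e) (Finsupp.single x a) = 0 := by
  simp [genAction, h]

theorem genAction_ghost_of_mem {e : E} {x : X} (h : x ∈ B.eset e) (a : A) :
    B.genAction wt (.ghost e) (Finsupp.single x a) =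
      Finsupp.single ((B.σEquiv e).symm ⟨x, h⟩ : X) (a * ((wt e)⁻¹ : Aˣ).val) := by
  simp [genAction, h]

theorem genAction_ghost_of_notMem {e : E} {x : X} (h : x ∉ B.eset e) (a : A) :
    B.genAction wt (.ghost e) (Finsupp.single x a) = 0 := by
  simp [genAction, h]

theorem genAction_edge_ghost {e : E} {x : X} (h : x ∈ B.eset e) (a : A) :
    B.genAction wt (.edge e) (B.genAction wt (.ghost e) (Finsupp.single x a)) =
      Finsupp.single x a := by
  rw [genAction_ghost_of_mem B wt h, genAction_edge_of_mem B wt (Subtype.coe_prop _)]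
  have := (B.σEquiv e).apply_symm_apply ⟨x, h⟩
  rw [Subtype.coe_eta]
  change Finsupp.single ((B.σEquiv e ((B.σEquiv e).symm ⟨x, h⟩) : B.eset e) : X) _ = _
  rw [this, mul_assoc, Units.inv_mul, mul_one]

theorem genAction_ghost_edge {e : E} {x : X} (h : x ∈ B.vset (G.r e)) (a : A) :
    B.genAction wt (.ghost e) (B.genAction wt (.edge e) (Finsupp.single x a)) =
      Finsupp.single x a := by
  rw [genAction_edge_of_mem B wt h, genAction_ghost_of_mem B wt (Subtype.coe_prop _)]
  have := (B.σEquiv e).symm_apply_apply ⟨x, h⟩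
  rw [Subtype.coe_eta]
  change Finsupp.single ((B.σEquiv e).symm (B.σEquiv e ⟨x, h⟩) : X) _ = _
  rw [this, mul_assoc, Units.mul_inv, mul_one]

variable {K : Type*} [Field K] [Algebra K A]

theorem genAction_rel : LPA.Respects K G (B.genAction wt) := by
  intro a b hab
  have hgen : ∀ g, MonoidAlgebra.liftMagma K (FreeSemigroup.lift (B.genAction wt))
      (LeavittFree.gen K g) = B.genAction wt g := by
    intro g
    simp [LeavittFree.gen]
  have hv : ∀ {v w : V} {x : X}, x ∈ B.vset v → x ∈ B.vset w → v = w := by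
    intro v w x h h'
    by_contra hne
    exact Set.disjoint_left.mp (B.vset_disjoint v w hne) h h'
  have he : ∀ {e f : E} {x : X}, x ∈ B.eset e → x ∈ B.eset f → e = f := by
    intro e f x h h'
    by_contra hne
    exact Set.disjoint_left.mp (B.eset_disjoint e f hne) h h'
  induction hab with
  | smul k a b _ ih => rw [map_smul, map_smul, ih]
  | vert_mul_self v =>
    rw [map_mul, hgen]
    refine Finsupp.lhom_ext fun x a => ?_
    rw [Module.End.mul_apply]
    by_cases h : x ∈ B.vset v
    · rw [genAction_vert_of_mem B wt h, genAction_vert_of_mem B wt h]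
    · rw [genAction_vert_of_notMem B wt h, map_zero]
  | vert_mul_ne v w hne =>
    rw [map_mul, hgen, hgen, map_zero]
    refine Finsupp.lhom_ext fun x a => ?_
    rw [Module.End.mul_apply, LinearMap.zero_apply]
    by_cases h : x ∈ B.vset w
    · rw [genAction_vert_of_mem B wt h, genAction_vert_of_notMem B wt fun h' => hne (hv h' h)]
    · rw [genAction_vert_of_notMem B wt h, map_zero]
  | s_mul_edge e =>
    rw [map_mul, hgen, hgen]
    refine Finsupp.lhom_ext fun x a => ?_
    rw [Module.End.mul_apply]
    by_cases h : x ∈ B.vset (G.r e)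
    · rw [genAction_edge_of_mem B wt h,
        genAction_vert_of_mem B wt (B.eset_subset e (Subtype.coe_prop _))]
    · rw [genAction_edge_of_notMem B wt h, map_zero]
  | edge_mul_r e =>
    rw [map_mul, hgen, hgen]
    refine Finsupp.lhom_ext fun x a => ?_
    rw [Module.End.mul_apply]
    by_cases h : x ∈ B.vset (G.r e)
    · rw [genAction_vert_of_mem B wt h]
    · rw [genAction_vert_of_notMem B wt h, genAction_edge_of_notMem B wt h, map_zero]
  | r_mul_ghost e =>
    rw [map_mul, hgen, hgen]
    refine Finsupp.lhom_ext fun x a => ?_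
    rw [Module.End.mul_apply]
    by_cases h : x ∈ B.eset e
    · rw [genAction_ghost_of_mem B wt h, genAction_vert_of_mem B wt (Subtype.coe_prop _)]
    · rw [genAction_ghost_of_notMem B wt h, map_zero]
  | ghost_mul_s e =>
    rw [map_mul, hgen, hgen]
    refine Finsupp.lhom_ext fun x a => ?_
    rw [Module.End.mul_apply]
    by_cases h : x ∈ B.vset (G.s e)
    · rw [genAction_vert_of_mem B wt h]
    · rw [genAction_vert_of_notMem B wt h,
        genAction_ghost_of_notMem B wt fun h' => h (B.eset_subset e h'), map_zero]
  | ck1_self e =>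
    rw [map_mul, hgen, hgen, hgen]
    refine Finsupp.lhom_ext fun x a => ?_
    rw [Module.End.mul_apply]
    by_cases h : x ∈ B.vset (G.r e)
    · rw [genAction_ghost_edge B wt h, genAction_vert_of_mem B wt h]
    · rw [genAction_edge_of_notMem B wt h, genAction_vert_of_notMem B wt h, map_zero]
  | ck1_ne e f hne =>
    rw [map_mul, hgen, hgen, map_zero]
    refine Finsupp.lhom_ext fun x a => ?_
    rw [Module.End.mul_apply, LinearMap.zero_apply]
    by_cases h : x ∈ B.vset (G.r f)
    · rw [genAction_edge_of_mem B wt h,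
        genAction_ghost_of_notMem B wt fun h' => hne (he h' (Subtype.coe_prop _))]
    · rw [genAction_edge_of_notMem B wt h, map_zero]
  | ck2 v hreg =>
    rw [map_sum, hgen]
    simp only [map_mul, hgen]
    refine Finsupp.lhom_ext fun x a => ?_
    rw [LinearMap.sum_apply]
    simp only [Module.End.mul_apply]
    by_cases h : x ∈ B.vset v
    · rw [genAction_vert_of_mem B wt h]
      have hx := h
      rw [B.cover v hreg, Set.mem_iUnion₂] at hx
      obtain ⟨e, hev, hxe⟩ := hx
      rw [Finset.sum_eq_single e, genAction_edge_ghost B wt hxe]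
      · intro f _ hfe
        rw [genAction_ghost_of_notMem B wt fun h' => hfe (he h' hxe), map_zero]
      · intro hne
        exact absurd ((Set.Finite.mem_toFinset _).mpr hev) hne
    · rw [genAction_vert_of_notMem B wt h, Finset.sum_eq_zero]
      intro e hev
      rw [Set.Finite.mem_toFinset] at hev
      have hev' : G.s e = v := hev
      rw [genAction_ghost_of_notMem B wt fun h' => h (hev' ▸ B.eset_subset e h'), map_zero]

variable (K) in
/-- The module on the free `A`-module with basis `X`, twisted by the units `wt`. -/
noncomputable def twistedModule : LeftModule (LPA K G) (X →₀ A) where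
  toFun a := (LPA.lift (K := K) (G := G) (B.genAction wt) (B.genAction_rel wt) a).toAddMonoidHom
  map_mul' a b := by rw [map_mul]; rfl
  map_zero' := by rw [map_zero]; rfl
  map_add' a b := by rw [map_add]; rfl

variable (K) in
/-- The module `M(X)` of a branching system: the `K`-vector space with basis `X`, on which
`v · x = x` if `x ∈ X_v`, `e · x = σ_e(x)` if `x ∈ X_{r(e)}`, `e^* · x = σ_e⁻¹(x)` if `x ∈ X_e`, and
these products are `0` otherwise. -/
noncomputable def module : LeftModule (LPA K G) (X →₀ K) :=
  B.twistedModule (fun _ => (1 : Kˣ)) K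

end BranchingSystem

/-! ### Chen modules -/

namespace DirGraph

variable {V E : Type*} (G : DirGraph V E)

/-- Infinite paths `e₁e₂…`, as sequences of edges. -/
structure InfPath where
  edge : ℕ → E
  valid : ∀ n, G.r (edge n) = G.s (edge (n + 1))

variable {G}

theorem InfPath.ext {α β : G.InfPath} (h : ∀ n, α.edge n = β.edge n) : α = β := by
  cases α; cases β
  congr
  exact funext h

def InfPath.TailEquiv (α β : G.InfPath) : Prop :=
  ∃ m n, ∀ k, α.edge (m + k) = β.edge (n + k)

/-- `α` is tail equivalent to `ddd…`. -/
def InfPath.TailEquivCycle (α : G.InfPath) (d : List E) : Prop :=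
  ∃ m n, ∀ k, d[(n + k) % d.length]? = some (α.edge (m + k))

/-- The infinite path `eβ`. -/
def InfPath.cons (e : E) (β : G.InfPath) (h : G.s (β.edge 0) = G.r e) : G.InfPath where
  edge n := Nat.casesOn n e β.edge
  valid n := by
    cases n with
    | zero => exact h.symm
    | succ n => exact β.valid n

def InfPath.tail (β : G.InfPath) : G.InfPath where
  edge n := β.edge (n + 1)
  valid n := β.valid (n + 1)

theorem InfPath.TailEquiv.cons {α β : G.InfPath} (hαβ : α.TailEquiv β) (e : E)
    (h : G.s (β.edge 0) = G.r e) : α.TailEquiv (β.cons e h) := by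
  obtain ⟨m, n, hk⟩ := hαβ
  refine ⟨m, n + 1, fun k => ?_⟩
  rw [hk, Nat.add_right_comm]
  rfl

theorem InfPath.TailEquiv.tail {α β : G.InfPath} (hαβ : α.TailEquiv β) :
    α.TailEquiv β.tail := by
  obtain ⟨m, n, hk⟩ := hαβ
  refine ⟨m + 1, n, fun k => ?_⟩
  rw [Nat.add_right_comm, Nat.add_assoc, hk]
  rfl

/-- The branching system of all infinite paths tail equivalent to `α`. -/
def infPathSystem (α : G.InfPath) : BranchingSystem G {β : G.InfPath // α.TailEquiv β} where
  vset v := {β | G.s (β.1.edge 0) = v}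
  eset e := {β | β.1.edge 0 = e}
  σ e β := ⟨⟨β.1.1.cons e β.2, β.1.2.cons e β.2⟩, rfl⟩
  vset_disjoint v w h := Set.disjoint_left.mpr fun _ h₁ h₂ => h (h₁.symm.trans h₂)
  eset_disjoint e f h := Set.disjoint_left.mpr fun _ h₁ h₂ => h (h₁.symm.trans h₂)
  eset_subset e _ h := congrArg G.s h
  σ_bijective e := by
    constructor
    · intro β γ h
      refine Subtype.ext (Subtype.ext (InfPath.ext fun n => ?_))
      exact congrArg (fun x => x.1.1.edge (n + 1)) h
    · rintro ⟨⟨β, hβ⟩, h⟩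
      have h' : β.edge 0 = e := h
      refine ⟨⟨⟨β.tail, hβ.tail⟩, ?_⟩, ?_⟩
      · change G.s (β.edge 1) = G.r e
        rw [← h', β.valid 0]
      · refine Subtype.ext (Subtype.ext (InfPath.ext fun n => ?_))
        cases n with
        | zero => exact h'.symm
        | succ n => rfl
  cover v _ := by
    ext β
    simp

/-- The branching system of all finite paths (given by their source and their edges) that end at
`v`, where `v` is a sink or an infinite emitter. -/
def endingSystem (v : V) (hv : G.IsSink v ∨ G.IsInfiniteEmitter v) :
    BranchingSystem G {p : V × List E // G.IsPath p.1 p.2 v} where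
  vset w := {p | p.1.1 = w}
  eset e := {p | p.1.2.head? = some e}
  σ e p := ⟨⟨(G.s e, e :: p.1.1.2), rfl, by
    have h : p.1.1.1 = G.r e := p.2
    have hp := p.1.2
    rwa [h] at hp⟩, rfl⟩
  vset_disjoint v w h := Set.disjoint_left.mpr fun _ h₁ h₂ => h (h₁.symm.trans h₂)
  eset_disjoint e f h := Set.disjoint_left.mpr fun _ h₁ h₂ =>
    h (Option.some_injective _ (h₁.symm.trans h₂))
  eset_subset e := by
    rintro ⟨⟨u, l⟩, hp⟩ h
    cases l with
    | nil => simp at h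
    | cons f l =>
      have hf : f = e := by simpa using h
      subst hf
      exact hp.1.symm
  σ_bijective e := by
    constructor
    · rintro ⟨⟨⟨u, l⟩, hp⟩, h⟩ ⟨⟨⟨u', l'⟩, hp'⟩, h'⟩ heq
      have hl : l = l' := by
        have := congrArg (fun x => x.1.1.2.tail) heq
        simpa using this
      have hu : u = G.r e := h
      have hu' : u' = G.r e := h'
      subst hl hu hu'
      rfl
    · rintro ⟨⟨⟨u, l⟩, hp⟩, h⟩
      cases l with
      | nil => simp at h
      | cons f l =>
        have hf : f = e := by simpa using h
        subst hf
        refine ⟨⟨⟨(G.r f, l), hp.2⟩, rfl⟩, ?_⟩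
        obtain ⟨h₁, h₂⟩ := hp
        have h₃ : G.s f = u := h₁
        subst h₃
        rfl
  cover w hw := by
    ext ⟨⟨u, l⟩, hp⟩
    simp only [Set.mem_ofPred_eq, Set.mem_iUnion, exists_prop]
    cases l with
    | nil =>
      constructor
      · intro h
        have h₁ : u = v := hp
        have h₂ : w = v := by rw [← h, h₁]
        subst h₂
        exact absurd hv (not_or.mpr hw)
      · rintro ⟨e, -, h⟩
        simp at h
    | cons f l =>
      have h₁ : G.s f = u := hp.1
      constructor
      · intro h
        exact ⟨f, h₁.trans h, rfl⟩
      · rintro ⟨e, h, h'⟩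
        have hf : f = e := by simpa using h'
        subst hf
        exact h₁.symm.trans h

end DirGraph

/-- The Chen module `V_[α]` of an infinite path `α`. -/
noncomputable def chenInfPath (K : Type*) {V E : Type*} [Field K] {G : DirGraph V E}
    (α : G.InfPath) : LeftModule (LPA K G) ({β : G.InfPath // α.TailEquiv β} →₀ K) :=
  (DirGraph.infPathSystem α).module K

/-- The Chen module `N_v` of a sink or an infinite emitter `v`. -/
noncomputable def chenVertex (K : Type*) {V E : Type*} [Field K] (G : DirGraph V E)
    (v : V) (hv : G.IsSink v ∨ G.IsInfiniteEmitter v) :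
    LeftModule (LPA K G) ({p : V × List E // G.IsPath p.1 p.2 v} →₀ K) :=
  (DirGraph.endingSystem v hv).module K

/-- The `K`-algebra `K[x, x⁻¹]/(f)`, a field if `f` is irreducible. -/
abbrev LaurentQuot {K : Type*} [Field K] (f : LaurentPolynomial K) : Type _ :=
  LaurentPolynomial K ⧸ Ideal.span {f}

/-- The class of `x` in `K[x, x⁻¹]/(f)`, as a unit. -/
noncomputable def laurentRoot {K : Type*} [Field K] (f : LaurentPolynomial K) :
    (LaurentQuot f)ˣ :=
  Units.map (Ideal.Quotient.mk (Ideal.span {f})).toMonoidHom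
    (LaurentPolynomial.isUnit_T (R := K) 1).unit

open Classical in
/-- The twisted Chen module `V_[α]^f`, where `α` is tail equivalent to `ddd…` for a cycle `d` and
`f` is an irreducible element of `K[x, x⁻¹]`: with `K' = K[x, x⁻¹]/(f)`, it is the module `V_[α]`
over `L_{K'}(E)`, twisted by the automorphism that multiplies the first edge of `d` by the class of
`x` and its ghost edge by the inverse of that class, and regarded as a module over `L_K(E)`. -/
noncomputable def chenTwisted {K : Type*} {V E : Type*} [Field K] {G : DirGraph V E}
    (α : G.InfPath) (d : List E) (f : LaurentPolynomial K) :
    LeftModule (LPA K G) ({β : G.InfPath // α.TailEquiv β} →₀ LaurentQuot f) :=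
  (DirGraph.infPathSystem α).twistedModule
    (fun e => if d.head? = some e then laurentRoot f else 1) K

/-! ### The module `N_c^v` -/

namespace DirGraph

variable {V E : Type*} {G : DirGraph V E}

theorem isPath_append {u w : V} {l l' : List E} :
    G.IsPath u (l ++ l') w ↔ ∃ x, G.IsPath u l x ∧ G.IsPath x l' w := by
  induction l generalizing u with
  | nil => simp [IsPath]
  | cons e l ih => simp [IsPath, ih, and_assoc]

theorem IsPath.tgt_unique {u w w' : V} {l : List E} (h : G.IsPath u l w) (h' : G.IsPath u l w') :
    w = w' := by
  induction l generalizing u with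
  | nil => exact h.symm.trans h'
  | cons e l ih => exact ih h.2 h'.2

theorem IsPath.nodup_of_minimal {u w : V} {l : List E} (h : G.IsPath u l w)
    (hmin : ∀ l', G.IsPath u l' w → l.length ≤ l'.length) : (l.map G.s).Nodup := by
  induction l generalizing u with
  | nil => simp
  | cons e l ih =>
    rw [List.map_cons, List.nodup_cons]
    constructor
    · intro hmem
      obtain ⟨f, hf, hfe⟩ := List.mem_map.mp hmem
      obtain ⟨a, b, rfl⟩ := List.append_of_mem hf
      obtain ⟨x, -, hx⟩ := isPath_append.mp h.2
      have := hmin (f :: b) ⟨hfe.trans h.1, hx.2⟩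
      simp at this
      omega
    · refine ih h.2 fun l' hl' => ?_
      have := hmin (e :: l') ⟨h.1, hl'⟩
      simpa using this

theorem IsCycle.exists_path {c : List E} (hc : G.IsCycle c) {u w : V} (hu : u ∈ G.cycleVerts c)
    (hw : w ∈ G.cycleVerts c) : ∃ l, G.IsPath u l w := by
  obtain ⟨-, ⟨x, hx⟩, -⟩ := hc
  obtain ⟨e, he, rfl⟩ := hu
  obtain ⟨f, hf, rfl⟩ := hw
  obtain ⟨a, b, rfl⟩ := List.append_of_mem he
  obtain ⟨y, -, hy⟩ := isPath_append.mp hx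
  obtain ⟨a', b', h'⟩ := List.append_of_mem hf
  rw [h'] at hx
  obtain ⟨z, hz, hz'⟩ := isPath_append.mp hx
  have h₁ : G.IsPath (G.s e) (e :: b) x := ⟨rfl, hy.2⟩
  have h₂ : G.s f = z := hz'.1
  exact ⟨(e :: b) ++ a', isPath_append.mpr ⟨x, h₁, h₂ ▸ hz⟩⟩

theorem IsCycle.range_mem {c : List E} (hc : G.IsCycle c) {e : E} (he : e ∈ c) :
    G.r e ∈ G.cycleVerts c := by
  obtain ⟨-, ⟨x, hx⟩, -⟩ := hc
  obtain ⟨a, b, rfl⟩ := List.append_of_mem he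
  obtain ⟨y, hy, hy'⟩ := isPath_append.mp hx
  cases b with
  | cons f b => exact ⟨f, by simp, hy'.2.1⟩
  | nil =>
    have h : G.r e = x := hy'.2
    cases a with
    | nil => exact ⟨e, by simp, by rw [h]; exact hx.1⟩
    | cons g a => exact ⟨g, by simp, by rw [h]; exact hx.1⟩

theorem IsExclusive.edge_mem {c : List E} (hc : G.IsExclusive c) {e : E} {l : List E} {w : V}
    (he : G.s e ∈ G.cycleVerts c) (hl : G.IsPath (G.r e) l w) (hw : w ∈ G.cycleVerts c) :
    e ∈ c := by
  classical
  have hex : ∃ n l, G.IsPath (G.r e) l (G.s e) ∧ l.length = n := by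
    obtain ⟨l', hl'⟩ := hc.1.exists_path hw he
    exact ⟨_, l ++ l', isPath_append.mpr ⟨w, hl, hl'⟩, rfl⟩
  obtain ⟨l₀, hl₀, hlen⟩ := Nat.find_spec hex
  have hmin : ∀ l', G.IsPath (G.r e) l' (G.s e) → l₀.length ≤ l'.length := fun l' hl' =>
    hlen ▸ Nat.find_min' hex ⟨l', hl', rfl⟩
  have hcyc : G.IsCycle (e :: l₀) := by
    refine ⟨by simp, ⟨G.s e, rfl, hl₀⟩, ?_⟩
    rw [List.map_cons, List.nodup_cons]
    refine ⟨fun hmem => ?_, hl₀.nodup_of_minimal hmin⟩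
    obtain ⟨f, hf, hfe⟩ := List.mem_map.mp hmem
    obtain ⟨a, b, rfl⟩ := List.append_of_mem hf
    obtain ⟨x, hx, hx'⟩ := isPath_append.mp hl₀
    have h₁ : G.s f = x := hx'.1
    have := hmin a (by rw [← hfe, h₁]; exact hx)
    simp at this
  have := hc.2 _ hcyc ⟨G.s e, he, e, by simp, rfl⟩
  exact this.mem_iff.mpr (by simp)

theorem IsExclusive.edges_mem {c : List E} (hc : G.IsExclusive c) {v w : V} {l : List E}
    (hv : v ∈ G.cycleVerts c) (hl : G.IsPath v l w) (hw : w ∈ G.cycleVerts c) :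
    ∀ e ∈ l, e ∈ c := by
  induction l generalizing v with
  | nil => simp
  | cons e l ih =>
    have he : e ∈ c := hc.edge_mem (hl.1 ▸ hv) hl.2 hw
    intro f hf
    rcases List.mem_cons.mp hf with rfl | hf
    · exact he
    · exact ih (hc.1.range_mem he) hl.2 f hf

variable (G) in
/-- The set `Y^v`: its elements are the `pq^*`, where `p` is a path from `src` to `mid`, `q` is a
path from `v` to `mid`, and `mid` is a vertex of the cycle `c`. -/
structure YElem (c : List E) (v : V) where
  src : V
  mid : V
  p : List E
  q : List E
  hp : G.IsPath src p mid
  hq : G.IsPath v q mid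
  hmid : mid ∈ G.cycleVerts c

namespace YElem

variable {c : List E} {v : V}

theorem ext_of_edges {y z : G.YElem c v} (hp : y.p = z.p) (hq : y.q = z.q) : y = z := by
  obtain ⟨s, m, p, q, h₁, h₂, h₃⟩ := y
  obtain ⟨s', m', p', q', h₁', h₂', h₃'⟩ := z
  dsimp only at hp hq
  subst hp hq
  obtain rfl := h₂.tgt_unique h₂'
  cases p with
  | nil =>
    obtain rfl : s = s' := Eq.trans h₁ h₁'.symm
    rfl
  | cons e p =>
    obtain rfl : s = s' := h₁.1.symm.trans h₁'.1
    rfl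

open Classical in
/-- The reduction function, given by `red(pee^*q^*) = red(pq^*)`, and by `red(pq^*) = pq^*` if `p`
and `q` do not end with the same edge. -/
noncomputable def red (y : G.YElem c v) : G.YElem c v :=
  if h : ∃ z : G.YElem c v, ∃ e, y.p = z.p ++ [e] ∧ y.q = z.q ++ [e] then red h.choose else y
termination_by y.p.length
decreasing_by
  obtain ⟨e, he, -⟩ := h.choose_spec
  have := congrArg List.length he
  rw [List.length_append, List.length_singleton] at this
  omega

/-- The degree `|p| - |q|` of `pq^*`. -/
def deg (y : G.YElem c v) : ℤ := (y.p.length : ℤ) - (y.q.length : ℤ)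

/-- The element `epq^*`. -/
def cons (e : E) (y : G.YElem c v) (h : y.src = G.r e) : G.YElem c v where
  src := G.s e
  mid := y.mid
  p := e :: y.p
  q := y.q
  hp := ⟨rfl, h ▸ y.hp⟩
  hq := y.hq
  hmid := y.hmid

/-- The lists `p` and `q` do not end with the same edge. -/
def NoCommonEnd (p q : List E) : Prop := ∀ p' q' e, p = p' ++ [e] → q ≠ q' ++ [e]

theorem NoCommonEnd.eq_nil {p q t : List E} (h : NoCommonEnd (p ++ t) (q ++ t)) : t = [] := by
  rcases List.eq_nil_or_concat t with rfl | ⟨t, e, rfl⟩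
  · rfl
  · exact absurd (by simp) (h (p ++ t) (q ++ t) e (by simp))

theorem NoCommonEnd.unique {a b a' b' t t' : List E} (h : NoCommonEnd a b)
    (h' : NoCommonEnd a' b') (h₁ : a ++ t = a' ++ t') (h₂ : b ++ t = b' ++ t') :
    a = a' ∧ b = b' := by
  rcases List.append_eq_append_iff.mp h₁ with ⟨u, rfl, rfl⟩ | ⟨u, rfl, rfl⟩
  · rw [← List.append_assoc, List.append_left_inj] at h₂
    subst h₂
    obtain rfl := h'.eq_nil
    simp
  · rw [← List.append_assoc, List.append_left_inj] at h₂
    subst h₂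
    obtain rfl := h.eq_nil
    simp

theorem red_spec (y : G.YElem c v) :
    y.red.src = y.src ∧ ∃ t, y.p = y.red.p ++ t ∧ y.q = y.red.q ++ t := by
  induction y using red.induct with
  | case1 y h ih =>
    rw [red, dif_pos h]
    obtain ⟨e, hp, hq⟩ := h.choose_spec
    generalize h.choose = z at *
    obtain ⟨h₁, t, hp', hq'⟩ := ih
    refine ⟨h₁.trans ?_, t ++ [e], ?_, ?_⟩
    · have hyp := y.hp
      have hyq := y.hq
      rw [hp] at hyp
      rw [hq] at hyq
      obtain ⟨x, hx, hx'⟩ := isPath_append.mp hyp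
      obtain ⟨x', hx₁, hx₁'⟩ := isPath_append.mp hyq
      obtain rfl := hx₁.tgt_unique z.hq
      obtain rfl : x = z.mid := hx'.1.symm.trans hx₁'.1
      have hz := z.hp
      revert hz hx
      cases z.p with
      | nil => exact fun h h' => Eq.trans h' h.symm
      | cons f l => exact fun h h' => h'.1.symm.trans h.1
    · rw [hp, ← List.append_assoc, ← hp']
    · rw [hq, ← List.append_assoc, ← hq']
  | case2 y h =>
    rw [red, dif_neg h]
    exact ⟨rfl, [], by simp, by simp⟩

theorem red_eq_self {y : G.YElem c v} (h : NoCommonEnd y.p y.q) : y.red = y := by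
  rw [red, dif_neg]
  rintro ⟨z, e, hp, hq⟩
  exact h _ _ _ hp hq

theorem exists_step (hc : G.IsExclusive c) (hv : v ∈ G.cycleVerts c) {y : G.YElem c v}
    (h : ¬ NoCommonEnd y.p y.q) : ∃ z : G.YElem c v, ∃ e, y.p = z.p ++ [e] ∧ y.q = z.q ++ [e] := by
  unfold NoCommonEnd at h
  push Not at h
  obtain ⟨p', q', e, hp, hq⟩ := h
  have hyp := y.hp
  have hyq := y.hq
  have hmem := hc.edges_mem hv hyq y.hmid e (by simp [hq])
  rw [hp] at hyp
  rw [hq] at hyq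
  obtain ⟨x, hx, hx'⟩ := isPath_append.mp hyp
  obtain ⟨x', hx₁, hx₁'⟩ := isPath_append.mp hyq
  have h₁ : G.s e = x := hx'.1
  have h₂ : G.s e = x' := hx₁'.1
  subst h₁ h₂
  exact ⟨⟨y.src, G.s e, p', q', hx, hx₁, e, hmem, rfl⟩, e, hp, hq⟩

theorem red_noCommonEnd (hc : G.IsExclusive c) (hv : v ∈ G.cycleVerts c) (y : G.YElem c v) :
    NoCommonEnd y.red.p y.red.q := by
  induction y using red.induct with
  | case1 y h ih =>
    rw [red, dif_pos h]
    exact ih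
  | case2 y h =>
    rw [red, dif_neg h]
    by_contra h'
    exact h (exists_step hc hv h')

theorem red_eq {y z : G.YElem c v} (hc : G.IsExclusive c) (hv : v ∈ G.cycleVerts c)
    (hz : NoCommonEnd z.p z.q) {t : List E} (hp : y.p = z.p ++ t) (hq : y.q = z.q ++ t) :
    y.red = z := by
  obtain ⟨-, t', hp', hq'⟩ := y.red_spec
  obtain ⟨h₁, h₂⟩ := (red_noCommonEnd hc hv y).unique hz (hp'.symm.trans hp) (hq'.symm.trans hq)
  exact ext_of_edges h₁ h₂

theorem red_red (hc : G.IsExclusive c) (hv : v ∈ G.cycleVerts c) (y : G.YElem c v) :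
    y.red.red = y.red :=
  red_eq_self (red_noCommonEnd hc hv y)

theorem noCommonEnd_of_red_eq (hc : G.IsExclusive c) (hv : v ∈ G.cycleVerts c) {y : G.YElem c v}
    (h : y.red = y) : NoCommonEnd y.p y.q :=
  h ▸ red_noCommonEnd hc hv y

theorem red_cons_red (hc : G.IsExclusive c) (hv : v ∈ G.cycleVerts c) (y : G.YElem c v) (e : E)
    (h : y.src = G.r e) :
    (y.red.cons e (y.red_spec.1.trans h)).red = (y.cons e h).red := by
  obtain ⟨-, t, hp, hq⟩ := y.red_spec
  obtain ⟨-, t', hp', hq'⟩ := (y.red.cons e (y.red_spec.1.trans h)).red_spec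
  refine (red_eq hc hv (red_noCommonEnd hc hv _) (t := t' ++ t) ?_ ?_).symm
  · rw [← List.append_assoc, ← hp']
    change e :: y.p = e :: y.red.p ++ t
    rw [List.cons_append, ← hp]
  · rw [← List.append_assoc, ← hq']
    exact hq

end YElem

variable (G) in
/-- The set `X^v` of reduced elements of `Y^v`. -/
def XElem (c : List E) (v : V) : Type _ := {y : G.YElem c v // y.red = y}

/-- The branching system `X^v` of an exclusive cycle `c` and a vertex `v` of `c`. -/
noncomputable def exclusiveSystem {c : List E} (hc : G.IsExclusive c) {v : V}
    (hv : v ∈ G.cycleVerts c) : BranchingSystem G (G.XElem c v) where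
  vset w := {x | x.1.src = w}
  eset e := {x | ∃ (y : G.YElem c v) (h : y.src = G.r e), x.1 = (y.cons e h).red}
  σ e x := ⟨⟨(x.1.1.cons e x.2).red, YElem.red_red hc hv _⟩, x.1.1, x.2, rfl⟩
  vset_disjoint v w h := Set.disjoint_left.mpr fun _ h₁ h₂ => h (h₁.symm.trans h₂)
  eset_disjoint e f hef := by
    refine Set.disjoint_left.mpr fun x hxe hxf => hef ?_
    have key : ∀ g, x ∈ {x : G.XElem c v | ∃ (y : G.YElem c v) (h : y.src = G.r g),
        x.1 = (y.cons g h).red} →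
        (∃ l, x.1.p = g :: l) ∨ (x.1.p = [] ∧ g ∈ c ∧ G.s g = x.1.src) := by
      rintro g ⟨y, h, hx⟩
      obtain ⟨hs, t, hp, hq⟩ := (y.cons g h).red_spec
      rw [← hx] at hs hp hq
      have hp' : g :: y.p = x.1.p ++ t := hp
      have hq' : y.q = x.1.q ++ t := hq
      cases hxp : x.1.p with
      | nil =>
        rw [hxp, List.nil_append] at hp'
        refine .inr ⟨rfl, hc.edges_mem hv y.hq y.hmid g ?_, hs.symm⟩
        rw [hq', ← hp']
        simp
      | cons f l =>
        rw [hxp, List.cons_append, List.cons.injEq] at hp'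
        exact .inl ⟨l, by rw [hp'.1]⟩
    rcases key e hxe with ⟨l, hl⟩ | ⟨hl, he, hse⟩ <;>
      rcases key f hxf with ⟨l', hl'⟩ | ⟨hl', hf, hsf⟩
    · rw [hl, List.cons.injEq] at hl'
      exact hl'.1
    · simp [hl] at hl'
    · simp [hl] at hl'
    · exact List.inj_on_of_nodup_map hc.1.2.2 he hf (hse.trans hsf.symm)
  eset_subset e := by
    rintro x ⟨y, h, hx⟩
    have := (y.cons e h).red_spec.1
    rw [← hx] at this
    exact this
  σ_bijective e := by
    constructor
    · intro x x' hxx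
      have hn := YElem.noCommonEnd_of_red_eq hc hv x.1.2
      have hn' := YElem.noCommonEnd_of_red_eq hc hv x'.1.2
      have hred : (x.1.1.cons e x.2).red = (x'.1.1.cons e x'.2).red :=
        congrArg (fun z => z.1.1) hxx
      obtain ⟨-, t, hp, hq⟩ := (x.1.1.cons e x.2).red_spec
      obtain ⟨-, t', hp', hq'⟩ := (x'.1.1.cons e x'.2).red_spec
      rw [← hred] at hp' hq'
      generalize (x.1.1.cons e x.2).red = z at hp hq hp' hq'
      replace hp : e :: x.1.1.p = z.p ++ t := hp
      replace hp' : e :: x'.1.1.p = z.p ++ t' := hp'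
      replace hq : x.1.1.q = z.q ++ t := hq
      replace hq' : x'.1.1.q = z.q ++ t' := hq'
      refine Subtype.ext (Subtype.ext ?_)
      cases hz : z.p with
      | nil =>
        have aux : ∀ {a b t : List E}, YElem.NoCommonEnd a b → e :: a = [] ++ t → b = z.q ++ t →
            a = [] := by
          intro a b t hn h₁ h₂
          rw [List.nil_append] at h₁
          rw [← h₁] at h₂
          refine YElem.NoCommonEnd.eq_nil (p := []) (q := z.q ++ [e]) ?_
          simpa [h₂] using hn
        rw [hz] at hp hp'
        have h₁ := aux hn hp hq
        have h₂ := aux hn' hp' hq'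
        refine YElem.ext_of_edges (h₁.trans h₂.symm) ?_
        rw [hq, hq', ← List.nil_append t, ← List.nil_append t', ← hp, ← hp', h₁, h₂]
      | cons g l =>
        rw [hz, List.cons_append, List.cons.injEq] at hp hp'
        rw [hp.2, hq] at hn
        rw [hp'.2, hq'] at hn'
        have h₁ := hn.eq_nil
        have h₂ := hn'.eq_nil
        subst h₁ h₂
        exact YElem.ext_of_edges (hp.2.trans hp'.2.symm) (hq.trans hq'.symm)
    · rintro ⟨x, y, h, hx⟩
      refine ⟨⟨⟨y.red, YElem.red_red hc hv y⟩, y.red_spec.1.trans h⟩, ?_⟩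
      refine Subtype.ext (Subtype.ext ?_)
      exact (YElem.red_cons_red hc hv y e h).trans hx.symm
  cover w _ := by
    ext x
    simp only [Set.mem_ofPred_eq, Set.mem_iUnion, exists_prop]
    constructor
    · intro hw
      have hn := YElem.noCommonEnd_of_red_eq hc hv x.2
      have hxp := x.1.hp
      cases hl : x.1.p with
      | nil =>
        rw [hl] at hxp
        have hsm : x.1.src = x.1.mid := hxp
        obtain ⟨f, hf, hfm⟩ := x.1.hmid
        refine ⟨f, by rw [hfm, ← hsm, hw], ?_⟩
        refine ⟨⟨G.r f, G.r f, [], x.1.q ++ [f], rfl, ?_, hc.1.range_mem hf⟩, rfl, ?_⟩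
        · exact isPath_append.mpr ⟨x.1.mid, x.1.hq, hfm, rfl⟩
        · refine (YElem.red_eq hc hv hn (t := [f]) ?_ rfl).symm
          rw [hl]
          rfl
      | cons f l =>
        rw [hl] at hxp
        refine ⟨f, hxp.1.trans hw, ⟨G.r f, x.1.mid, l, x.1.q, hxp.2, x.1.hq, x.1.hmid⟩, rfl, ?_⟩
        refine (YElem.red_eq hc hv hn (t := []) ?_ ?_).symm
        · rw [hl, List.append_nil]
          rfl
        · rw [List.append_nil]
          rfl
    · rintro ⟨e, he, y, h, hx⟩
      have := (y.cons e h).red_spec.1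
      rw [← hx] at this
      exact this.trans he

end DirGraph

/-- The module `N_c^v` of an exclusive cycle `c` and a vertex `v` of `c`. -/
noncomputable def exclusiveModule (K : Type*) {V E : Type*} [Field K] {G : DirGraph V E}
    {c : List E} (hc : G.IsExclusive c) {v : V} (hv : v ∈ G.cycleVerts c) :
    LeftModule (LPA K G) (G.XElem c v →₀ K) :=
  (DirGraph.exclusiveSystem hc hv).module K

/-- The component of degree `n` of `N_c^v`: the span of the basis elements of degree `n`. -/
noncomputable def exclusiveGrading (K : Type*) {V E : Type*} [Field K] (G : DirGraph V E) (c : List E) (v : V)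
    (n : ℤ) : AddSubgroup (G.XElem c v →₀ K) :=
  (Finsupp.supported K K {x : G.XElem c v | x.1.deg = n}).toAddSubgroup

/-! ### Modules and graded modules over non-unital rings -/

namespace LeftModule

variable {R M N : Type*} [NonUnitalRing R] [AddCommGroup M] [AddCommGroup N]

/-- The annihilator of a module. -/
def ann (ρ : LeftModule R M) : TwoSidedIdeal R := TwoSidedIdeal.ker ρ

def IsSubmodule (ρ : LeftModule R M) (P : AddSubgroup M) : Prop :=
  ∀ a, ∀ m ∈ P, ρ a m ∈ P

def IsSimple (ρ : LeftModule R M) : Prop :=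
  Nontrivial M ∧ ∀ P, IsSubmodule ρ P → P = ⊥ ∨ P = ⊤

def Isomorphic (ρ : LeftModule R M) (τ : LeftModule R N) : Prop :=
  ∃ φ : M ≃+ N, ∀ a m, φ (ρ a m) = τ a (φ m)

/-- The subgroups `ℳ n` make the module graded over the ring `R`, which is graded by `𝒜`. -/
def IsGraded (𝒜 : ℤ → AddSubgroup R) (ρ : LeftModule R M) (ℳ : ℤ → AddSubgroup M) : Prop :=
  DirectSum.IsInternal ℳ ∧
    ∀ i j, ∀ a ∈ 𝒜 i, ∀ m ∈ ℳ j, ρ a m ∈ ℳ (i + j)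

/-- A module graded by `ℳ` has no graded submodules except `0` and itself, and is nonzero. A
submodule `P` is graded if it is the sum of the subgroups `P ∩ ℳ n`. -/
def IsGradedSimple (ρ : LeftModule R M) (ℳ : ℤ → AddSubgroup M) : Prop :=
  Nontrivial M ∧ ∀ P, IsSubmodule ρ P → P = ⨆ n, P ⊓ ℳ n → P = ⊥ ∨ P = ⊤

def GradedIsomorphic (ρ : LeftModule R M) (ℳ : ℤ → AddSubgroup M) (τ : LeftModule R N)
    (𝒩 : ℤ → AddSubgroup N) : Prop :=
  ∃ φ : M ≃+ N, (∀ a m, φ (ρ a m) = τ a (φ m)) ∧ ∀ n m, m ∈ ℳ n ↔ φ m ∈ 𝒩 n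

/-- The grading of the shifted module `M(k)`, where `M(k)_n = M_{n + k}`. -/
def shift (ℳ : ℤ → AddSubgroup M) (k : ℤ) : ℤ → AddSubgroup M := fun n => ℳ (n + k)

end LeftModule

namespace LPA

variable (K : Type*) {V E : Type*} [Field K] (G : DirGraph V E)

/-- The element `p` of `L_K(E)`, where `p` is the path with source `u` and edges `l`. -/
noncomputable def path (u : V) (l : List E) : LPA K G :=
  l.foldl (fun a e => a * edge K G e) (vert K G u)

/-- The element `p^*` of `L_K(E)`, where `p` is the path with source `u` and edges `l`. -/
noncomputable def ghostPath (u : V) (l : List E) : LPA K G :=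
  l.foldl (fun a e => ghost K G e * a) (vert K G u)

/-- The component of degree `n` of `L_K(E)`: the span of all `pq^*` with `|p| - |q| = n`. -/
noncomputable def grading (n : ℤ) : AddSubgroup (LPA K G) :=
  (Submodule.span K {a | ∃ u u' w l l', G.IsPath u l w ∧ G.IsPath u' l' w ∧
    (l.length : ℤ) - (l'.length : ℤ) = n ∧ a = path K G u l * ghostPath K G u' l'}).toAddSubgroup

/-- The element `v^H = v - ∑ ee^*`, where the sum runs over the edges `e` from `v` to vertices that
are not in `H`, for a vertex `v` for which there are only finitely many such edges. -/
noncomputable def breakingElem (H : Set V) (v : V) : LPA K G :=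
  vert K G v - ∑ᶠ e ∈ {e | G.s e = v ∧ G.r e ∉ H}, edge K G e * ghost K G e

/-- The ideal `I(H, S)`. -/
noncomputable def idealOf (H S : Set V) : TwoSidedIdeal (LPA K G) :=
  TwoSidedIdeal.span (vert K G '' H ∪ breakingElem K G H '' S)

end LPA

/-! Let `γ` be the infinite path `ccc…` read from `v`. Write `γ = qγ'` and send `pq^*` to the
infinite path `pγ'` together with the integer `|p| - |q|`. Cancelling a common final edge changes
neither, so `X^v` becomes the set of infinite paths tail equivalent to `γ`, each with a lag that
records how the common tails are aligned (`exists_equiv_lagPath`). Thus `N_c^v` is the Chen module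
of `γ` in which the turns of the cycle are counted. The proof works with this system, `lagSystem γ`.

Annihilator (`ann_lagSystem`, valid for every infinite path `γ`). A combination of paths is
determined, on the vertex at which `z` begins, by its value on `z`: from `pz` the lag recovers
`|p|`, hence `p`. General elements are handled by induction on the length of the ghost parts, since
right multiplication by an edge shortens them. At a vertex with only finitely many edges to the
complement of `H`, the element `w^H` reduces `w` to a sum of `ee^*`. At a vertex with infinitely
many, one of these edges is not met by the ghost edges of the given element, and there the base case
applies.

Graded simplicity (`lagSystem_eq_top`). Distinct elements of the same lag are distinct paths, so a
long enough ghost path isolates one term of a homogeneous element, and any two elements have a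
common tail with equal lags. The module is not simple because forgetting the lag maps it onto the
Chen module of `γ` and identifies `(γ, 0)` with `(γ, |c|)`.

Shifts and isomorphisms. Replacing `γ` by a tail shifts the lag. The vertices outside the
annihilator form the root of `c`, and the root determines an exclusive cycle. A graded isomorphism
yields an element of lag `0` that begins at `v`; such a path cannot leave the cycle, so periodicity
forces `v = w`.

Chen modules. Suppose that the annihilators agree. In the modules of infinite paths, twisted or not,
every basis path that begins at `v` is `γ`, so the cycle acts there by a scalar algebraic over `K`,
and a nonzero polynomial in the cycle annihilates the module; on `N_c^v` its powers have different
degrees and it does not. In `N_u` the vertex `u` must lie on `c`, and with `e` the edge of `c` at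
`u`, the element `u - ee^*` annihilates `N_c^v` but fixes the trivial path at `u`. -/

namespace LPA

variable {K V E : Type*} [Field K] {G : DirGraph V E}

/-! ### Paths, ghost paths and the filtration by ghost length -/

theorem mk_eq_of_rel {a b : LeavittFree K V E} (h : LeavittRel K G a b) : mk K G a = mk K G b :=
  Quotient.sound' (RingConGen.Rel.of _ _ h)

theorem vert_mul_self (v : V) : vert K G v * vert K G v = vert K G v :=
  mk_eq_of_rel (.vert_mul_self v)

theorem vert_mul_ne {v w : V} (h : v ≠ w) : vert K G v * vert K G w = 0 :=
  (mk_eq_of_rel (.vert_mul_ne v w h)).trans (map_zero (mk K G))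

theorem s_mul_edge (e : E) : vert K G (G.s e) * edge K G e = edge K G e :=
  mk_eq_of_rel (.s_mul_edge e)

theorem edge_mul_r (e : E) : edge K G e * vert K G (G.r e) = edge K G e :=
  mk_eq_of_rel (.edge_mul_r e)

theorem r_mul_ghost (e : E) : vert K G (G.r e) * ghost K G e = ghost K G e :=
  mk_eq_of_rel (.r_mul_ghost e)

theorem ghost_mul_s (e : E) : ghost K G e * vert K G (G.s e) = ghost K G e :=
  mk_eq_of_rel (.ghost_mul_s e)

theorem ghost_mul_edge_self (e : E) : ghost K G e * edge K G e = vert K G (G.r e) :=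
  mk_eq_of_rel (.ck1_self e)

theorem ghost_mul_edge_ne {e f : E} (h : e ≠ f) : ghost K G e * edge K G f = 0 :=
  (mk_eq_of_rel (.ck1_ne e f h)).trans (map_zero (mk K G))

theorem vert_eq_sum {v : V} (hv : G.IsRegular v) :
    vert K G v = ∑ e ∈ (Set.not_infinite.mp hv.2).toFinset, edge K G e * ghost K G e := by
  refine (mk_eq_of_rel (.ck2 v hv)).trans ?_
  rw [map_sum]
  rfl

theorem vert_mul_edge_ne {v : V} {e : E} (h : v ≠ G.s e) : vert K G v * edge K G e = 0 := by
  rw [← s_mul_edge, ← mul_assoc, vert_mul_ne h, zero_mul]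

theorem ghost_mul_vert_ne {v : V} {e : E} (h : G.s e ≠ v) : ghost K G e * vert K G v = 0 := by
  rw [← ghost_mul_s, mul_assoc, vert_mul_ne h, mul_zero]

/-- A linear subspace that is closed under left multiplication by the generators and contains the
generators is the whole algebra. -/
theorem mem_of_forall_gen_mul {P : Submodule K (LPA K G)}
    (hgen : ∀ g, mk K G (LeavittFree.gen K g) ∈ P)
    (hmul : ∀ g, ∀ a ∈ P, mk K G (LeavittFree.gen K g) * a ∈ P) (a : LPA K G) : a ∈ P := by
  obtain ⟨a, rfl⟩ := mk_surjective a
  induction a using MonoidAlgebra.induction_linear with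
  | zero => rw [map_zero]; exact P.zero_mem
  | add a b ha hb => rw [map_add]; exact P.add_mem ha hb
  | single w k =>
    have hk : MonoidAlgebra.single w k
        = k • (MonoidAlgebra.single w 1 : LeavittFree K V E) := by
      rw [MonoidAlgebra.smul_single, smul_eq_mul, mul_one]
    rw [hk, mk_smul]
    refine P.smul_mem k ?_
    clear hk
    induction w using FreeSemigroup.recOnMul with
    | ih1 g => exact hgen g
    | ih2 g w _ ih =>
      have : (MonoidAlgebra.single (FreeSemigroup.of g * w) 1 : LeavittFree K V E)
          = LeavittFree.gen K g * MonoidAlgebra.single w 1 := by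
        rw [LeavittFree.gen, MonoidAlgebra.single_mul_single, mul_one]
      rw [this, map_mul]
      exact hmul g _ ih

/-- Paths are left folds and so grow at their last edge. Pulling out a left factor makes it possible
to split off the first edge, as in `path_cons`; `foldl_ghost_mul` does the same for ghost paths. -/
theorem foldl_mul_edge (a b : LPA K G) (l : List E) :
    l.foldl (fun a e => a * edge K G e) (a * b) = a * l.foldl (fun a e => a * edge K G e) b := by
  induction l generalizing b with
  | nil => rfl
  | cons e l ih => rw [List.foldl_cons, List.foldl_cons, mul_assoc, ih]

theorem foldl_ghost_mul (a b : LPA K G) (l : List E) :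
    l.foldl (fun a e => ghost K G e * a) (a * b) = l.foldl (fun a e => ghost K G e * a) a * b := by
  induction l generalizing a with
  | nil => rfl
  | cons e l ih => rw [List.foldl_cons, List.foldl_cons, ← mul_assoc, ih]

theorem path_nil (u : V) : path K G u [] = vert K G u := rfl

theorem ghostPath_nil (u : V) : ghostPath K G u [] = vert K G u := rfl

theorem path_cons (e : E) (l : List E) :
    path K G (G.s e) (e :: l) = edge K G e * path K G (G.r e) l := by
  rw [path, List.foldl_cons, s_mul_edge, path, ← foldl_mul_edge, edge_mul_r]

theorem ghostPath_cons (e : E) (l : List E) :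
    ghostPath K G (G.s e) (e :: l) = ghostPath K G (G.r e) l * ghost K G e := by
  rw [ghostPath, List.foldl_cons, ghost_mul_s, ghostPath, ← foldl_ghost_mul, r_mul_ghost]

theorem path_append_singleton (u : V) (l : List E) (e : E) :
    path K G u (l ++ [e]) = path K G u l * edge K G e := by
  simp [path]

theorem ghostPath_append_singleton (u : V) (l : List E) (e : E) :
    ghostPath K G u (l ++ [e]) = ghost K G e * ghostPath K G u l := by
  simp [ghostPath]

theorem path_mul_vert {u w : V} {l : List E} (h : G.IsPath u l w) :
    path K G u l * vert K G w = path K G u l := by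
  induction l generalizing u with
  | nil =>
    obtain rfl : u = w := h
    exact vert_mul_self u
  | cons e l ih =>
    obtain ⟨rfl, h⟩ := h
    rw [path_cons, mul_assoc, ih h]

theorem vert_mul_path {u : V} (l : List E) :
    vert K G u * path K G u l = path K G u l := by
  rw [path, ← foldl_mul_edge, vert_mul_self]

theorem vert_mul_path_ne {u w : V} (h : w ≠ u) (l : List E) :
    vert K G w * path K G u l = 0 := by
  rw [← vert_mul_path, ← mul_assoc, vert_mul_ne h, zero_mul]

theorem ghostPath_mul_vert {u : V} (l : List E) :
    ghostPath K G u l * vert K G u = ghostPath K G u l := by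
  rw [ghostPath, ← foldl_ghost_mul, vert_mul_self]

theorem vert_mul_ghostPath {u w : V} {l : List E} (h : G.IsPath u l w) :
    vert K G w * ghostPath K G u l = ghostPath K G u l := by
  induction l generalizing u with
  | nil =>
    obtain rfl : u = w := h
    exact vert_mul_self u
  | cons e l ih =>
    obtain ⟨rfl, h⟩ := h
    rw [ghostPath_cons, ← mul_assoc, ih h]

variable (K G) in
/-- The span of all `pq^*` with `|q| ≤ n`. -/
noncomputable def ghostFiltration (n : ℕ) : Submodule K (LPA K G) :=
  Submodule.span K {a | ∃ u u' w l l', G.IsPath u l w ∧ G.IsPath u' l' w ∧ l'.length ≤ n ∧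
    a = path K G u l * ghostPath K G u' l'}

variable (K G) in
/-- The span of all paths. -/
noncomputable def pathSpan : Submodule K (LPA K G) :=
  Submodule.span K {a | ∃ u w l, G.IsPath u l w ∧ a = path K G u l}

theorem path_mem_pathSpan {u w : V} {l : List E} (h : G.IsPath u l w) :
    path K G u l ∈ pathSpan K G :=
  Submodule.subset_span ⟨u, w, l, h, rfl⟩

theorem ghostFiltration_mono {m n : ℕ} (h : m ≤ n) :
    ghostFiltration K G m ≤ ghostFiltration K G n :=
  Submodule.span_mono fun _ ⟨u, u', w, l, l', h₁, h₂, h₃, h₄⟩ =>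
    ⟨u, u', w, l, l', h₁, h₂, h₃.trans h, h₄⟩

theorem mul_ghostPath_mem {n : ℕ} {u u' w : V} {l l' : List E} (h : G.IsPath u l w)
    (h' : G.IsPath u' l' w) (hn : l'.length ≤ n) :
    path K G u l * ghostPath K G u' l' ∈ ghostFiltration K G n :=
  Submodule.subset_span ⟨u, u', w, l, l', h, h', hn, rfl⟩

theorem ghostFiltration_zero : ghostFiltration K G 0 = pathSpan K G := by
  refine le_antisymm (Submodule.span_le.mpr ?_) (Submodule.span_le.mpr ?_)
  · rintro _ ⟨u, u', w, l, l', h, h', hn, rfl⟩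
    obtain rfl : l' = [] := by simpa using hn
    obtain rfl : u' = w := h'
    rw [ghostPath_nil, path_mul_vert h]
    exact path_mem_pathSpan h
  · rintro _ ⟨u, w, l, h, rfl⟩
    rw [← path_mul_vert h]
    exact mul_ghostPath_mem h (l' := []) rfl le_rfl

theorem gen_mul_mem_ghostFiltration (g : LeavittGen V E) {n : ℕ} {a : LPA K G}
    (ha : a ∈ ghostFiltration K G n) :
    mk K G (LeavittFree.gen K g) * a ∈ ghostFiltration K G (n + 1) := by
  induction ha using Submodule.span_induction with
  | zero => rw [mul_zero]; exact Submodule.zero_mem _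
  | add a b _ _ ha hb => rw [mul_add]; exact Submodule.add_mem _ ha hb
  | smul k a _ ha => rw [mul_smul_comm]; exact Submodule.smul_mem _ k ha
  | mem a ha =>
    obtain ⟨u, u', w, l, l', h, h', hn, rfl⟩ := ha
    rw [← mul_assoc]
    cases g with
    | vert v =>
      change vert K G v * _ * _ ∈ _
      by_cases hv : v = u
      · rw [hv, vert_mul_path]
        exact mul_ghostPath_mem h h' (by omega)
      · rw [vert_mul_path_ne hv, zero_mul]
        exact Submodule.zero_mem _
    | edge e =>
      change edge K G e * _ * _ ∈ _
      by_cases hv : G.r e = u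
      · subst hv
        rw [← path_cons]
        exact mul_ghostPath_mem ⟨rfl, h⟩ h' (by omega)
      · rw [← edge_mul_r, mul_assoc (edge K G e), vert_mul_path_ne hv, mul_zero, zero_mul]
        exact Submodule.zero_mem _
    | ghost e =>
      change ghost K G e * _ * _ ∈ _
      -- Only a ghost edge that meets a trivial `p` lengthens the ghost part; otherwise it cancels
      -- the first edge of `p` or gives zero.
      cases l with
      | nil =>
        obtain rfl : u = w := h
        rw [path_nil]
        by_cases hv : G.s e = u
        · subst hv
          have hp : G.IsPath u' (l' ++ [e]) (G.r e) :=
            DirGraph.isPath_append.mpr ⟨_, h', rfl, rfl⟩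
          rw [ghost_mul_s, ← ghostPath_append_singleton, ← vert_mul_ghostPath hp]
          exact mul_ghostPath_mem (l := []) rfl hp (by simpa using hn)
        · rw [ghost_mul_vert_ne hv, zero_mul]
          exact Submodule.zero_mem _
      | cons f l =>
        obtain ⟨rfl, h⟩ := h
        rw [path_cons, ← mul_assoc]
        by_cases hf : e = f
        · subst hf
          rw [ghost_mul_edge_self, vert_mul_path]
          exact mul_ghostPath_mem h h' (by omega)
        · rw [ghost_mul_edge_ne hf, zero_mul, zero_mul]
          exact Submodule.zero_mem _

/-- The union of the filtration is a subspace because the filtration is increasing, and left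
multiplication by a generator raises the index by at most one. -/
theorem exists_mem_ghostFiltration (a : LPA K G) : ∃ n, a ∈ ghostFiltration K G n := by
  have hdir : Directed (· ≤ ·) (ghostFiltration K G) :=
    Monotone.directed_le fun _ _ h => ghostFiltration_mono h
  rw [← Submodule.mem_iSup_of_directed _ hdir]
  refine mem_of_forall_gen_mul ?_ ?_ a
  · intro g
    rw [Submodule.mem_iSup_of_directed _ hdir]
    refine ⟨1, ?_⟩
    cases g with
    | vert v =>
      change vert K G v ∈ _
      rw [← vert_mul_self]
      exact mul_ghostPath_mem (l := []) (l' := []) rfl rfl (by simp)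
    | edge e =>
      change edge K G e ∈ _
      have := mul_ghostPath_mem (K := K) (G := G) (n := 1) (u := G.s e) (l := [e]) (l' := [])
        ⟨rfl, rfl⟩ rfl (by simp)
      rwa [path_cons, path_nil, ghostPath_nil, edge_mul_r, edge_mul_r] at this
    | ghost e =>
      change ghost K G e ∈ _
      have := mul_ghostPath_mem (K := K) (G := G) (n := 1) (u' := G.s e) (l := []) (l' := [e])
        rfl ⟨rfl, rfl⟩ (by simp)
      rwa [ghostPath_cons, path_nil, ghostPath_nil, r_mul_ghost, r_mul_ghost] at this
  · intro g a ha
    rw [Submodule.mem_iSup_of_directed _ hdir] at ha ⊢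
    obtain ⟨n, hn⟩ := ha
    exact ⟨n + 1, gen_mul_mem_ghostFiltration g hn⟩

/-- The rightmost factor of `q^*` is the ghost of the first edge of `q`; it either cancels against
`e` or gives zero. If `q` is trivial, `e` extends `p` or gives zero, and no ghost edge appears, so
truncated subtraction is harmless at `n = 0`. -/
theorem mul_edge_mem_ghostFiltration (e : E) {n : ℕ} {a : LPA K G}
    (ha : a ∈ ghostFiltration K G n) : a * edge K G e ∈ ghostFiltration K G (n - 1) := by
  induction ha using Submodule.span_induction with
  | zero => rw [zero_mul]; exact Submodule.zero_mem _
  | add a b _ _ ha hb => rw [add_mul]; exact Submodule.add_mem _ ha hb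
  | smul k a _ ha => rw [smul_mul_assoc]; exact Submodule.smul_mem _ k ha
  | mem a ha =>
    obtain ⟨u, u', w, l, l', h, h', hn, rfl⟩ := ha
    rw [mul_assoc]
    cases l' with
    | nil =>
      obtain rfl : u' = w := h'
      rw [ghostPath_nil]
      by_cases hv : u' = G.s e
      · subst hv
        have hp : G.IsPath u (l ++ [e]) (G.r e) := DirGraph.isPath_append.mpr ⟨_, h, rfl, rfl⟩
        rw [s_mul_edge, ← path_append_singleton, ← path_mul_vert hp]
        exact mul_ghostPath_mem hp (l' := []) rfl (by simp)
      · rw [vert_mul_edge_ne hv, mul_zero]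
        exact Submodule.zero_mem _
    | cons f l' =>
      obtain ⟨rfl, h'⟩ := h'
      rw [ghostPath_cons, mul_assoc (ghostPath K G _ _)]
      by_cases hf : f = e
      · subst hf
        rw [ghost_mul_edge_self, ghostPath_mul_vert]
        exact mul_ghostPath_mem h h' (by simpa using Nat.le_sub_one_of_lt hn)
      · rw [ghost_mul_edge_ne hf, mul_zero, mul_zero]
        exact Submodule.zero_mem _

/-- Every element of the algebra agrees on `w`, up to a linear combination of paths, with a finite
sum of multiples of ghost edges. -/
theorem exists_pathSpan_sub (w : V) (a : LPA K G) : ∃ b ∈ pathSpan K G, ∃ S : Finset E,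
    (∀ e ∈ S, G.s e = w) ∧ ∀ T : Finset E, S ⊆ T → (∀ e ∈ T, G.s e = w) →
      (a - b) * vert K G w = ∑ e ∈ T, (a - b) * (edge K G e * ghost K G e) := by
  classical
  obtain ⟨n, ha⟩ := exists_mem_ghostFiltration a
  induction ha using Submodule.span_induction with
  | zero => exact ⟨0, Submodule.zero_mem _, ∅, by simp, by simp⟩
  | add a a' _ _ ha ha' =>
    obtain ⟨b, hb, S, hS, h⟩ := ha
    obtain ⟨b', hb', S', hS', h'⟩ := ha'
    -- Allowing every finite `T` that contains `S` is what lets the identities for two summands be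
    -- added over one index set.
    refine ⟨b + b', Submodule.add_mem _ hb hb', S ∪ S', ?_, ?_⟩
    · intro e he
      rcases Finset.mem_union.mp he with he | he
      exacts [hS e he, hS' e he]
    · intro T hT hTw
      rw [add_sub_add_comm]
      simp only [add_mul, Finset.sum_add_distrib]
      rw [h T (Finset.union_subset_left hT) hTw, h' T (Finset.union_subset_right hT) hTw]
  | smul k a _ ha =>
    obtain ⟨b, hb, S, hS, h⟩ := ha
    refine ⟨k • b, Submodule.smul_mem _ k hb, S, hS, fun T hT hTw => ?_⟩
    rw [← smul_sub]
    simp only [smul_mul_assoc, ← Finset.smul_sum]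
    rw [h T hT hTw]
  | mem a ha =>
    obtain ⟨u, u', x, l, l', h, h', -, rfl⟩ := ha
    cases l' with
    | nil =>
      obtain rfl : u' = x := h'
      refine ⟨path K G u l, path_mem_pathSpan h, ∅, by simp, ?_⟩
      rw [ghostPath_nil, path_mul_vert h, sub_self]
      simp
    | cons f l' =>
      obtain ⟨rfl, h'⟩ := h'
      -- Here the monomial is `zf^*`. It kills all edges except `f`, and `f^* = f^*ff^*` accounts
      -- for the single remaining term.
      refine ⟨0, Submodule.zero_mem _, if G.s f = w then {f} else ∅, ?_, ?_⟩
      · intro e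
        split_ifs with hf
        · rw [Finset.mem_singleton]
          rintro rfl
          exact hf
        · simp
      · intro T hT hTw
        rw [sub_zero, ghostPath_cons, ← mul_assoc]
        generalize path K G u l * ghostPath K G (G.r f) l' = z
        have hne : ∀ e ∈ T, e ≠ f → z * ghost K G f * (edge K G e * ghost K G e) = 0 := by
          intro e _ hef
          rw [mul_assoc, ← mul_assoc (ghost K G f), ghost_mul_edge_ne hef.symm, zero_mul, mul_zero]
        by_cases hf : G.s f = w
        · rw [if_pos hf, Finset.singleton_subset_iff] at hT
          rw [Finset.sum_eq_single_of_mem f hT hne, mul_assoc, ← hf, ghost_mul_s, mul_assoc,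
            ← mul_assoc (ghost K G f), ghost_mul_edge_self, r_mul_ghost]
        · rw [mul_assoc, ghost_mul_vert_ne hf, mul_zero, Finset.sum_eq_zero]
          exact fun e he => hne e he fun hef => hf (hef ▸ hTw e he)

end LPA

/-! ### Modules over non-unital rings, annihilators and isomorphisms -/

namespace LeftModule

variable {R M N : Type*} [NonUnitalRing R] [AddCommGroup M] [AddCommGroup N]

theorem mul_apply (ρ : LeftModule R M) (a b : R) (m : M) : ρ (a * b) m = ρ a (ρ b m) := by
  rw [map_mul]
  rfl

theorem add_apply (ρ : LeftModule R M) (a b : R) (m : M) : ρ (a + b) m = ρ a m + ρ b m := by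
  rw [map_add]
  rfl

theorem sub_apply (ρ : LeftModule R M) (a b : R) (m : M) : ρ (a - b) m = ρ a m - ρ b m := by
  rw [map_sub]
  rfl

theorem zero_apply (ρ : LeftModule R M) (m : M) : ρ 0 m = 0 := by
  rw [map_zero]
  rfl

theorem sum_apply (ρ : LeftModule R M) {ι : Type*} (s : Finset ι) (a : ι → R) (m : M) :
    ρ (∑ i ∈ s, a i) m = ∑ i ∈ s, ρ (a i) m := by
  classical
  induction s using Finset.induction_on with
  | empty => simp
  | insert i s hi ih => rw [Finset.sum_insert hi, Finset.sum_insert hi, add_apply, ih]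

theorem mem_ann_iff {ρ : LeftModule R M} {a : R} : a ∈ ann ρ ↔ ∀ m, ρ a m = 0 := by
  rw [ann, TwoSidedIdeal.mem_ker]
  exact ⟨fun h m => by rw [h]; rfl, fun h => AddMonoidHom.ext h⟩

theorem Isomorphic.ann_eq {ρ : LeftModule R M} {τ : LeftModule R N} (h : Isomorphic ρ τ) :
    ann ρ = ann τ := by
  obtain ⟨φ, hφ⟩ := h
  ext a
  rw [mem_ann_iff, mem_ann_iff]
  constructor
  · intro h m
    have := hφ a (φ.symm m)
    rwa [h, map_zero, φ.apply_symm_apply, eq_comm] at this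
  · intro h m
    rw [← φ.map_eq_zero_iff, hφ, h]

theorem GradedIsomorphic.isomorphic {ρ : LeftModule R M} {ℳ : ℤ → AddSubgroup M}
    {τ : LeftModule R N} {𝒩 : ℤ → AddSubgroup N} (h : GradedIsomorphic ρ ℳ τ 𝒩) :
    Isomorphic ρ τ :=
  let ⟨φ, hφ, _⟩ := h
  ⟨φ, hφ⟩

theorem Isomorphic.symm {ρ : LeftModule R M} {τ : LeftModule R N} (h : Isomorphic ρ τ) :
    Isomorphic τ ρ := by
  obtain ⟨φ, hφ⟩ := h
  refine ⟨φ.symm, fun a m => ?_⟩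
  rw [AddEquiv.symm_apply_eq, hφ, φ.apply_symm_apply]

theorem Isomorphic.trans {N' : Type*} [AddCommGroup N'] {ρ : LeftModule R M} {τ : LeftModule R N}
    {υ : LeftModule R N'} (h : Isomorphic ρ τ) (h' : Isomorphic τ υ) : Isomorphic ρ υ := by
  obtain ⟨φ, hφ⟩ := h
  obtain ⟨ψ, hψ⟩ := h'
  exact ⟨φ.trans ψ, fun a m => by
    rw [AddEquiv.trans_apply, hφ, hψ, AddEquiv.trans_apply]⟩

theorem GradedIsomorphic.symm {ρ : LeftModule R M} {ℳ : ℤ → AddSubgroup M}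
    {τ : LeftModule R N} {𝒩 : ℤ → AddSubgroup N} (h : GradedIsomorphic ρ ℳ τ 𝒩) :
    GradedIsomorphic τ 𝒩 ρ ℳ := by
  obtain ⟨φ, hφ, hd⟩ := h
  refine ⟨φ.symm, fun a m => ?_, fun n m => ?_⟩
  · rw [AddEquiv.symm_apply_eq, hφ, φ.apply_symm_apply]
  · rw [hd, φ.apply_symm_apply]

theorem GradedIsomorphic.trans {N' : Type*} [AddCommGroup N'] {ρ : LeftModule R M}
    {ℳ : ℤ → AddSubgroup M} {τ : LeftModule R N} {𝒩 : ℤ → AddSubgroup N} {υ : LeftModule R N'}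
    {𝒩' : ℤ → AddSubgroup N'} (h : GradedIsomorphic ρ ℳ τ 𝒩) (h' : GradedIsomorphic τ 𝒩 υ 𝒩') :
    GradedIsomorphic ρ ℳ υ 𝒩' := by
  obtain ⟨φ, hφ, hd⟩ := h
  obtain ⟨ψ, hψ, hd'⟩ := h'
  refine ⟨φ.trans ψ, fun a m => ?_, fun n m => ?_⟩
  · rw [AddEquiv.trans_apply, hφ, hψ, AddEquiv.trans_apply]
  · rw [hd, hd', AddEquiv.trans_apply]

theorem GradedIsomorphic.shift {ρ : LeftModule R M} {ℳ : ℤ → AddSubgroup M}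
    {τ : LeftModule R N} {𝒩 : ℤ → AddSubgroup N} (h : GradedIsomorphic ρ ℳ τ 𝒩) (k : ℤ) :
    GradedIsomorphic ρ (LeftModule.shift ℳ k) τ (LeftModule.shift 𝒩 k) := by
  obtain ⟨φ, hφ, hd⟩ := h
  exact ⟨φ, hφ, fun n m => hd (n + k) m⟩

/-- A module with a homomorphism that is neither zero nor injective is not simple. -/
theorem not_isSimple_of_hom {ρ : LeftModule R M} {τ : LeftModule R N} (ψ : M →+ N)
    (hψ : ∀ a m, ψ (ρ a m) = τ a (ψ m)) (h₀ : ψ ≠ 0) (h₁ : ¬ Function.Injective ψ) :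
    ¬ IsSimple ρ := by
  rintro ⟨-, h⟩
  rcases h ψ.ker fun a m hm => by
    rw [AddMonoidHom.mem_ker] at hm ⊢
    rw [hψ, hm, map_zero] with h | h
  · exact h₁ ((AddMonoidHom.ker_eq_bot_iff ψ).mp h)
  · refine h₀ (AddMonoidHom.ext fun m => ?_)
    exact AddMonoidHom.mem_ker.mp (h ▸ AddSubgroup.mem_top m)

end LeftModule

/-! ### Modules of branching systems: linearity, morphisms and degrees -/

namespace LPA

variable {K V E : Type*} [Field K] {G : DirGraph V E}

theorem lift_mk_gen {A : Type*} [NonUnitalRing A] [Module K A] [IsScalarTower K A A]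
    [SMulCommClass K A A] (F : LeavittGen V E → A) (hF : Respects K G F) (g : LeavittGen V E) :
    lift F hF (mk K G (LeavittFree.gen K g)) = F g := by
  change MonoidAlgebra.liftMagma K (FreeSemigroup.lift F) (LeavittFree.gen K g) = _
  simp [LeavittFree.gen]

theorem lift_smul {A : Type*} [NonUnitalRing A] [Module K A] [IsScalarTower K A A]
    [SMulCommClass K A A] (F : LeavittGen V E → A) (hF : Respects K G F) (k : K) (a : LPA K G) :
    lift F hF (k • a) = k • lift F hF a := by
  obtain ⟨a, rfl⟩ := mk_surjective a
  exact map_smul (MonoidAlgebra.liftMagma K (FreeSemigroup.lift F)) k a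

end LPA

namespace BranchingSystem

variable {K V E X X' : Type*} [Field K] {G : DirGraph V E} (B : BranchingSystem G X)
variable {A : Type*} [CommRing A] [Algebra K A] (wt : E → Aˣ)

theorem twistedModule_gen (g : LeavittGen V E) (m : X →₀ A) :
    B.twistedModule wt K (LPA.mk K G (LeavittFree.gen K g)) m = B.genAction wt g m := by
  change LPA.lift (B.genAction wt) (B.genAction_rel wt) _ m = _
  rw [LPA.lift_mk_gen]

theorem twistedModule_smul (k : K) (a : LPA K G) (m : X →₀ A) :
    B.twistedModule wt K (k • a) m = k • B.twistedModule wt K a m := by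
  change LPA.lift (B.genAction wt) (B.genAction_rel wt) _ m = _
  rw [LPA.lift_smul]
  rfl

theorem module_smul (k : K) (a : LPA K G) (m : X →₀ K) :
    B.module K (k • a) m = k • B.module K a m :=
  B.twistedModule_smul _ k a m

theorem twistedModule_map_smul (a : LPA K G) (k : A) (m : X →₀ A) :
    B.twistedModule wt K a (k • m) = k • B.twistedModule wt K a m :=
  map_smul (LPA.lift (B.genAction wt) (B.genAction_rel wt) a) k m

variable {B wt} in
theorem twistedModule_ann_iff {a : LPA K G} :
    a ∈ LeftModule.ann (B.twistedModule wt K) ↔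
      ∀ x, B.twistedModule wt K a (Finsupp.single x 1) = 0 := by
  rw [LeftModule.mem_ann_iff]
  refine ⟨fun h x => h _, fun h m => ?_⟩
  induction m using Finsupp.induction_linear with
  | zero => exact map_zero _
  | add m n hm hn => rw [map_add, hm, hn, add_zero]
  | single x k =>
    have : (Finsupp.single x k : X →₀ A) = k • Finsupp.single x 1 := by simp
    rw [this, twistedModule_map_smul, h, smul_zero]

/-- A map between branching systems that commutes with their structure. -/
structure IsMorphism (B : BranchingSystem G X) (B' : BranchingSystem G X') (φ : X → X') :
    Prop where
  mem_vset : ∀ w x, φ x ∈ B'.vset w ↔ x ∈ B.vset w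
  mem_eset : ∀ e x, φ x ∈ B'.eset e ↔ x ∈ B.eset e
  map_σ : ∀ e x h h', φ (B.σ e ⟨x, h⟩) = B'.σ e ⟨φ x, h'⟩

theorem σ_symm_mem (e : E) (x : B.eset e) : ((B.σEquiv e).symm x : X) ∈ B.vset (G.r e) :=
  Subtype.coe_prop _

theorem σ_σEquiv_symm {e : E} (x : B.eset e) :
    B.σ e ⟨(B.σEquiv e).symm x, B.σ_symm_mem e x⟩ = x :=
  (B.σEquiv e).apply_symm_apply x

theorem σEquiv_symm_eq {e : E} {x y : X} (hx : x ∈ B.eset e) (hy : y ∈ B.vset (G.r e))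
    (h : (B.σ e ⟨y, hy⟩ : X) = x) : ((B.σEquiv e).symm ⟨x, hx⟩ : X) = y := by
  have : (B.σEquiv e).symm ⟨x, hx⟩ = ⟨y, hy⟩ := by
    rw [Equiv.symm_apply_eq]
    exact Subtype.ext h.symm
  rw [this]

theorem IsMorphism.map_genAction {B : BranchingSystem G X} {B' : BranchingSystem G X'} {φ : X → X'}
    (hφ : IsMorphism B B' φ) (g : LeavittGen V E) (m : X →₀ K) :
    Finsupp.mapDomain φ (B.genAction (fun _ => (1 : Kˣ)) g m) =
      B'.genAction (fun _ => (1 : Kˣ)) g (Finsupp.mapDomain φ m) := by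
  induction m using Finsupp.induction_linear with
  | zero => simp
  | add m n hm hn => simp only [map_add, Finsupp.mapDomain_add, hm, hn]
  | single x a =>
    rw [Finsupp.mapDomain_single]
    cases g with
    | vert w =>
      by_cases h : x ∈ B.vset w
      · rw [genAction_vert_of_mem _ _ h, genAction_vert_of_mem _ _ ((hφ.mem_vset _ _).mpr h),
          Finsupp.mapDomain_single]
      · rw [genAction_vert_of_notMem _ _ h,
          genAction_vert_of_notMem _ _ (mt (hφ.mem_vset _ _).mp h), Finsupp.mapDomain_zero]
    | edge e =>
      by_cases h : x ∈ B.vset (G.r e)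
      · have h' := (hφ.mem_vset _ _).mpr h
        rw [genAction_edge_of_mem _ _ h, genAction_edge_of_mem _ _ h',
          Finsupp.mapDomain_single, hφ.map_σ e x h h']
      · rw [genAction_edge_of_notMem _ _ h,
          genAction_edge_of_notMem _ _ (mt (hφ.mem_vset _ _).mp h), Finsupp.mapDomain_zero]
    | ghost e =>
      by_cases h : x ∈ B.eset e
      · have h' := (hφ.mem_eset _ _).mpr h
        rw [genAction_ghost_of_mem _ _ h, genAction_ghost_of_mem _ _ h',
          Finsupp.mapDomain_single,
          σEquiv_symm_eq B' h' ((hφ.mem_vset _ _).mpr (B.σ_symm_mem e ⟨x, h⟩))]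
        rw [← hφ.map_σ e _ (B.σ_symm_mem e ⟨x, h⟩), σ_σEquiv_symm]
      · rw [genAction_ghost_of_notMem _ _ h,
          genAction_ghost_of_notMem _ _ (mt (hφ.mem_eset _ _).mp h), Finsupp.mapDomain_zero]

/-- The elements of the algebra whose action commutes with the map form a subspace that contains the
generators and is closed under left multiplication by them. -/
theorem IsMorphism.map_module {B : BranchingSystem G X} {B' : BranchingSystem G X'} {φ : X → X'}
    (hφ : IsMorphism B B' φ) (a : LPA K G) (m : X →₀ K) :
    Finsupp.mapDomain φ (B.module K a m) = B'.module K a (Finsupp.mapDomain φ m) := by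
  let P : Submodule K (LPA K G) :=
    { carrier := {a | ∀ m, Finsupp.mapDomain φ (B.module K a m) =
        B'.module K a (Finsupp.mapDomain φ m)}
      zero_mem' := fun m => by simp [Finsupp.mapDomain_zero]
      add_mem' := fun {a b} ha hb m => by
        rw [LeftModule.add_apply, LeftModule.add_apply, Finsupp.mapDomain_add, ha, hb]
      smul_mem' := fun k a ha m => by
        rw [module, module, twistedModule_smul, twistedModule_smul, Finsupp.mapDomain_smul]
        exact congrArg (k • ·) (ha m) }
  have hgen : ∀ g m, Finsupp.mapDomain φ (B.module K (LPA.mk K G (LeavittFree.gen K g)) m) =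
      B'.module K (LPA.mk K G (LeavittFree.gen K g)) (Finsupp.mapDomain φ m) := by
    intro g m
    rw [module, module, twistedModule_gen, twistedModule_gen, hφ.map_genAction]
  refine LPA.mem_of_forall_gen_mul (P := P) hgen ?_ a m
  intro g a ha m
  rw [LeftModule.mul_apply, LeftModule.mul_apply, hgen, ha]

theorem map_mem_supported {T : AddMonoid.End (X →₀ A)} {s t : Set X}
    (h : ∀ x ∈ s, ∀ a, T (Finsupp.single x a) ∈ Finsupp.supported A A t) {m : X →₀ A}
    (hm : m ∈ Finsupp.supported A A s) : T m ∈ Finsupp.supported A A t := by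
  rw [← Finsupp.sum_single m, Finsupp.sum, map_sum]
  exact Submodule.sum_mem _ fun x hx => h x ((Finsupp.mem_supported A m).mp hm hx) _

variable {B} in
-- The hypothesis says that edges raise the degree by one. Ghost edges act by the inverse bijections
-- and therefore lower it by one; vertices preserve it.
theorem module_grading_mem {deg : X → ℤ} (hdeg : ∀ e x, deg (B.σ e x) = deg x + 1) {i j : ℤ}
    {a : LPA K G} (ha : a ∈ LPA.grading K G i) {m : X →₀ K}
    (hm : m ∈ Finsupp.supported K K {x | deg x = j}) :
    B.module K a m ∈ Finsupp.supported K K {x | deg x = i + j} := by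
  have hvert : ∀ {n : ℤ} {m : X →₀ K} (w : V), m ∈ Finsupp.supported K K {x | deg x = n} →
      B.module K (LPA.vert K G w) m ∈ Finsupp.supported K K {x | deg x = n} := by
    intro n m w hm
    refine map_mem_supported (fun x hx k => ?_) hm
    change B.twistedModule _ K (LPA.mk K G (LeavittFree.gen K (.vert w))) _ ∈ _
    rw [twistedModule_gen]
    by_cases h : x ∈ B.vset w
    · rw [genAction_vert_of_mem _ _ h]
      exact Finsupp.single_mem_supported K k hx
    · rw [genAction_vert_of_notMem _ _ h]
      exact Submodule.zero_mem _
  have hedge : ∀ {n : ℤ} {m : X →₀ K} (e : E), m ∈ Finsupp.supported K K {x | deg x = n} →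
      B.module K (LPA.edge K G e) m ∈ Finsupp.supported K K {x | deg x = n + 1} := by
    intro n m e hm
    refine map_mem_supported (fun x hx k => ?_) hm
    change B.twistedModule _ K (LPA.mk K G (LeavittFree.gen K (.edge e))) _ ∈ _
    rw [twistedModule_gen]
    by_cases h : x ∈ B.vset (G.r e)
    · rw [genAction_edge_of_mem _ _ h]
      refine Finsupp.single_mem_supported K _ ?_
      rw [Set.mem_ofPred_eq] at hx ⊢
      rw [hdeg, hx]
    · rw [genAction_edge_of_notMem _ _ h]
      exact Submodule.zero_mem _
  have hghost : ∀ {n : ℤ} {m : X →₀ K} (e : E), m ∈ Finsupp.supported K K {x | deg x = n} →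
      B.module K (LPA.ghost K G e) m ∈ Finsupp.supported K K {x | deg x = n - 1} := by
    intro n m e hm
    refine map_mem_supported (fun x hx k => ?_) hm
    change B.twistedModule _ K (LPA.mk K G (LeavittFree.gen K (.ghost e))) _ ∈ _
    rw [twistedModule_gen]
    by_cases h : x ∈ B.eset e
    · rw [genAction_ghost_of_mem _ _ h]
      refine Finsupp.single_mem_supported K _ ?_
      have h' := hdeg e ⟨(B.σEquiv e).symm ⟨x, h⟩, B.σ_symm_mem e ⟨x, h⟩⟩
      rw [σ_σEquiv_symm] at h'
      rw [Set.mem_ofPred_eq] at hx ⊢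
      dsimp only at h'
      omega
    · rw [genAction_ghost_of_notMem _ _ h]
      exact Submodule.zero_mem _
  have hpath : ∀ {n : ℤ} {u w : V} {l : List E} {m : X →₀ K}, G.IsPath u l w →
      m ∈ Finsupp.supported K K {x | deg x = n} →
      B.module K (LPA.path K G u l) m ∈ Finsupp.supported K K {x | deg x = n + l.length} := by
    intro n u w l m hl hm
    induction l generalizing u with
    | nil => simpa [LPA.path_nil] using hvert u hm
    | cons e l ih =>
      obtain ⟨rfl, hl⟩ := hl
      rw [LPA.path_cons, LeftModule.mul_apply]
      have := hedge e (ih hl)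
      rwa [add_assoc] at this
  have hghostPath : ∀ {n : ℤ} {u w : V} {l : List E} {m : X →₀ K}, G.IsPath u l w →
      m ∈ Finsupp.supported K K {x | deg x = n} →
      B.module K (LPA.ghostPath K G u l) m ∈ Finsupp.supported K K {x | deg x = n - l.length} := by
    intro n u w l m hl hm
    induction l generalizing u n m with
    | nil => simpa [LPA.ghostPath_nil] using hvert u hm
    | cons e l ih =>
      obtain ⟨rfl, hl⟩ := hl
      rw [LPA.ghostPath_cons, LeftModule.mul_apply]
      have := ih hl (hghost e hm)
      rwa [sub_sub, add_comm (1 : ℤ)] at this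
  change a ∈ Submodule.span K _ at ha
  induction ha using Submodule.span_induction with
  | zero => rw [LeftModule.zero_apply]; exact Submodule.zero_mem _
  | add a b _ _ ha hb => rw [LeftModule.add_apply]; exact Submodule.add_mem _ ha hb
  | smul k a _ ha =>
    rw [module, twistedModule_smul]
    exact Submodule.smul_mem _ k ha
  | mem a ha =>
    obtain ⟨u, u', w, l, l', h, h', rfl, rfl⟩ := ha
    rw [LeftModule.mul_apply]
    have := hpath h (hghostPath h' hm)
    rwa [show j - (l'.length : ℤ) + l.length = l.length - l'.length + j by ring] at this

end BranchingSystem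

theorem Finsupp.isInternal_supported_fiber {X K : Type*} [Field K] (deg : X → ℤ) :
    DirectSum.IsInternal fun n : ℤ =>
      (Finsupp.supported K K {x | deg x = n}).toAddSubgroup := by
  have h : DirectSum.IsInternal fun n : ℤ => Finsupp.supported K K {x | deg x = n} := by
    refine DirectSum.isInternal_submodule_of_iSupIndep_of_iSup_eq_top (fun n => ?_) ?_
    · have hle : ⨆ j, ⨆ (_ : j ≠ n), Finsupp.supported K K {x | deg x = j}
          ≤ Finsupp.supported K K {x | deg x ≠ n} :=
        iSup₂_le fun j hj => Finsupp.supported_mono fun x hx hxn => hj (hx.symm.trans hxn)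
      refine Disjoint.mono_right hle (Finsupp.disjoint_supported_supported ?_)
      exact Set.disjoint_left.mpr fun x hx hx' => hx' hx
    · rw [← Finsupp.supported_iUnion, eq_top_iff, ← Finsupp.supported_univ]
      exact Finsupp.supported_mono fun x _ => Set.mem_iUnion.mpr ⟨deg x, rfl⟩
  exact h

/-! ### Prefixes and tails of infinite paths -/

namespace DirGraph

variable {V E : Type*} {G : DirGraph V E}

namespace InfPath

/-- The source of an infinite path. -/
abbrev src (β : G.InfPath) : V := G.s (β.edge 0)

/-- The first `n` edges of an infinite path. -/
def take (β : G.InfPath) (n : ℕ) : List E := (List.range n).map β.edge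

/-- The infinite path without its first `n` edges. -/
def drop (β : G.InfPath) (n : ℕ) : G.InfPath where
  edge k := β.edge (n + k)
  valid k := β.valid (n + k)

@[simp] theorem length_take (β : G.InfPath) (n : ℕ) : (β.take n).length = n := by simp [take]

theorem drop_zero (β : G.InfPath) : β.drop 0 = β := ext fun n => congrArg β.edge (Nat.zero_add n)

theorem drop_one (β : G.InfPath) : β.drop 1 = β.tail :=
  ext fun n => congrArg β.edge (Nat.add_comm 1 n)

theorem drop_drop (β : G.InfPath) (m n : ℕ) : (β.drop m).drop n = β.drop (m + n) :=
  ext fun k => congrArg β.edge (Nat.add_assoc m n k).symm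

theorem take_add (β : G.InfPath) (m n : ℕ) : β.take (m + n) = β.take m ++ (β.drop m).take n := by
  simp [take, List.range_add, drop]

theorem take_zero (β : G.InfPath) : β.take 0 = [] := rfl

theorem take_succ (β : G.InfPath) (n : ℕ) : β.take (n + 1) = β.edge 0 :: β.tail.take n := by
  rw [Nat.add_comm, take_add, drop_one]
  rfl

theorem take_eq_take {α β : G.InfPath} {m n : ℕ} (h : α.take n = β.take n) (hmn : m < n) :
    α.edge m = β.edge m := by
  have := congrArg (fun l => l[m]?) h
  simpa [take, hmn] using this

theorem eq_of_take_drop {α β : G.InfPath} {n : ℕ} (h : α.take n = β.take n)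
    (h' : α.drop n = β.drop n) : α = β := by
  refine ext fun m => ?_
  rcases lt_or_ge m n with hm | hm
  · exact take_eq_take h hm
  · obtain ⟨k, rfl⟩ := Nat.exists_eq_add_of_le hm
    exact congrArg (fun γ => γ.edge k) h'

theorem isPath_take (β : G.InfPath) (n : ℕ) : G.IsPath β.src (β.take n) (β.drop n).src := by
  induction n generalizing β with
  | zero => rfl
  | succ n ih =>
    rw [take_succ, Nat.add_comm, ← drop_drop, drop_one]
    refine ⟨rfl, ?_⟩
    have := ih β.tail
    rwa [src, show β.tail.edge 0 = β.edge 1 from rfl, ← β.valid 0] at this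

theorem exists_prepend {u : V} {l : List E} (β : G.InfPath) (h : G.IsPath u l β.src) :
    ∃ α : G.InfPath, α.src = u ∧ α.take l.length = l ∧ α.drop l.length = β := by
  induction l generalizing u with
  | nil => exact ⟨β, Eq.symm h, rfl, drop_zero β⟩
  | cons e l ih =>
    obtain ⟨α, h₁, h₂, h₃⟩ := ih h.2
    refine ⟨α.cons e h₁, h.1, ?_, ?_⟩
    · rw [List.length_cons, take_succ]
      exact congrArg (e :: ·) h₂
    · rw [List.length_cons, Nat.add_comm, ← drop_drop, drop_one]
      exact h₃

end InfPath

end DirGraph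

/-! ### Branching systems with infinite itineraries -/

namespace BranchingSystem

variable {K V E X : Type*} [Field K] {G : DirGraph V E}
variable {A : Type*} [CommRing A] [Algebra K A] {wt : E → Aˣ}

/-- The elements of the branching system have itineraries `π x`, which are infinite paths, and
`tl` removes their first edges. -/
structure HasItineraries (B : BranchingSystem G X) (π : X → G.InfPath) (tl : X → X) : Prop where
  mem_vset : ∀ w x, x ∈ B.vset w ↔ (π x).src = w
  mem_eset : ∀ e x, x ∈ B.eset e ↔ (π x).edge 0 = e
  π_tl : ∀ x, π (tl x) = (π x).tail
  σ_tl : ∀ x h, (B.σ ((π x).edge 0) ⟨tl x, h⟩ : X) = x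

namespace HasItineraries

variable {B : BranchingSystem G X} {π : X → G.InfPath} {tl : X → X}

theorem src_tl (hB : B.HasItineraries π tl) (x : X) : (π (tl x)).src = G.r ((π x).edge 0) := by
  rw [hB.π_tl, (π x).valid 0]
  rfl

theorem π_iterate (hB : B.HasItineraries π tl) (n : ℕ) (x : X) : π (tl^[n] x) = (π x).drop n := by
  induction n generalizing x with
  | zero => exact (π x).drop_zero.symm
  | succ n ih =>
    rw [Function.iterate_succ_apply, ih, hB.π_tl, ← DirGraph.InfPath.drop_one,
      DirGraph.InfPath.drop_drop, Nat.add_comm]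

theorem exists_cons (hB : B.HasItineraries π tl)
    {e : E} {x : X} (h : (π x).src = G.r e) : ∃ y, (π y).edge 0 = e ∧ tl y = x := by
  have hx := (hB.mem_vset _ _).mpr h
  set y := B.σ e ⟨x, hx⟩
  have hy := (hB.mem_eset _ _).mp y.2
  refine ⟨y, hy, ?_⟩
  have hs := hB.src_tl y
  rw [hy] at hs
  have hm := (hB.mem_vset _ _).mpr hs
  have h₁ : (B.σ e ⟨tl y, hm⟩ : X) = y := by
    have := hB.σ_tl y
    rw [hy] at this
    exact this hm
  -- Both `x` and `tl y` are sent to `y` by `σ_e`, which is injective.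
  exact congrArg Subtype.val ((B.σ_bijective e).1 (Subtype.ext h₁ : _ = B.σ e ⟨x, hx⟩))

theorem exists_prepend (hB : B.HasItineraries π tl)
    {u : V} {l : List E} {x : X} (h : G.IsPath u l (π x).src) :
    ∃ y, (π y).src = u ∧ (π y).take l.length = l ∧ tl^[l.length] y = x := by
  induction l generalizing u with
  | nil => exact ⟨x, Eq.symm h, rfl, rfl⟩
  | cons e l ih =>
    obtain ⟨z, h₁, h₂, h₃⟩ := ih h.2
    obtain ⟨y, hy, rfl⟩ := hB.exists_cons h₁
    refine ⟨y, by rw [DirGraph.InfPath.src, hy]; exact h.1, ?_, h₃⟩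
    rw [List.length_cons, DirGraph.InfPath.take_succ, hy, ← hB.π_tl, h₂]

theorem vert_apply (hB : B.HasItineraries π tl) {w : V} {x : X} (h : (π x).src = w) (a : A) :
    B.twistedModule wt K (LPA.vert K G w) (Finsupp.single x a) = Finsupp.single x a := by
  change B.twistedModule _ K (LPA.mk K G (LeavittFree.gen K (.vert w))) _ = _
  rw [twistedModule_gen, genAction_vert_of_mem _ _ ((hB.mem_vset _ _).mpr h)]

theorem vert_apply_ne (hB : B.HasItineraries π tl) {w : V} {x : X} (h : (π x).src ≠ w) (a : A) :
    B.twistedModule wt K (LPA.vert K G w) (Finsupp.single x a) = 0 := by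
  change B.twistedModule _ K (LPA.mk K G (LeavittFree.gen K (.vert w))) _ = _
  rw [twistedModule_gen, genAction_vert_of_notMem _ _ (mt (hB.mem_vset _ _).mp h)]

theorem edge_apply (hB : B.HasItineraries π tl) {e : E} {x : X} (h : (π x).edge 0 = e) (a : A) :
    B.twistedModule wt K (LPA.edge K G e) (Finsupp.single (tl x) a) =
      Finsupp.single x (a * wt e) := by
  subst h
  change B.twistedModule _ K (LPA.mk K G (LeavittFree.gen K (.edge _))) _ = _
  rw [twistedModule_gen, genAction_edge_of_mem _ _ ((hB.mem_vset _ _).mpr (hB.src_tl x)), hB.σ_tl]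

theorem ghost_apply (hB : B.HasItineraries π tl) {e : E} {x : X} (h : (π x).edge 0 = e) (a : A) :
    B.twistedModule wt K (LPA.ghost K G e) (Finsupp.single x a) =
      Finsupp.single (tl x) (a * ((wt e)⁻¹ : Aˣ).val) := by
  subst h
  change B.twistedModule _ K (LPA.mk K G (LeavittFree.gen K (.ghost _))) _ = _
  rw [twistedModule_gen, genAction_ghost_of_mem _ _ ((hB.mem_eset _ _).mpr rfl),
    B.σEquiv_symm_eq _ ((hB.mem_vset _ _).mpr (hB.src_tl x)) (hB.σ_tl x _)]

theorem ghost_apply_ne (hB : B.HasItineraries π tl) {e : E} {x : X} (h : (π x).edge 0 ≠ e) (a : A) :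
    B.twistedModule wt K (LPA.ghost K G e) (Finsupp.single x a) = 0 := by
  change B.twistedModule _ K (LPA.mk K G (LeavittFree.gen K (.ghost _))) _ = _
  rw [twistedModule_gen, genAction_ghost_of_notMem _ _ (mt (hB.mem_eset _ _).mp h)]

theorem path_apply (hB : B.HasItineraries π tl) (x : X) (n : ℕ) (a : A) :
    B.twistedModule wt K (LPA.path K G (π x).src ((π x).take n)) (Finsupp.single (tl^[n] x) a) =
      Finsupp.single x (a * ((((π x).take n).map wt).prod : Aˣ)) := by
  induction n generalizing x with
  | zero =>
    rw [DirGraph.InfPath.take_zero, LPA.path_nil, Function.iterate_zero_apply,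
      hB.vert_apply rfl]
    simp
  | succ n ih =>
    rw [DirGraph.InfPath.take_succ, LPA.path_cons, LeftModule.mul_apply,
      Function.iterate_succ_apply, ← hB.src_tl, ← hB.π_tl, ih, hB.edge_apply rfl, List.map_cons,
      List.prod_cons, Units.val_mul, mul_assoc, mul_comm (wt _ : A)]

theorem ghostPath_apply (hB : B.HasItineraries π tl) (x : X) (n : ℕ) (a : A) :
    B.twistedModule wt K (LPA.ghostPath K G (π x).src ((π x).take n)) (Finsupp.single x a) =
      Finsupp.single (tl^[n] x) (a * ((((π x).take n).map wt).prod⁻¹ : Aˣ)) := by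
  induction n generalizing x a with
  | zero =>
    rw [DirGraph.InfPath.take_zero, LPA.ghostPath_nil, Function.iterate_zero_apply,
      hB.vert_apply rfl]
    simp
  | succ n ih =>
    rw [DirGraph.InfPath.take_succ, LPA.ghostPath_cons, LeftModule.mul_apply,
      Function.iterate_succ_apply, hB.ghost_apply rfl, ← hB.src_tl, ← hB.π_tl, ih, List.map_cons,
      List.prod_cons, mul_inv, Units.val_mul, mul_assoc]

theorem ghostPath_apply_ne (hB : B.HasItineraries π tl)
    {u w : V} {l : List E} (hl : G.IsPath u l w) {x : X}
    (h : (π x).take l.length ≠ l) (a : A) :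
    B.twistedModule wt K (LPA.ghostPath K G u l) (Finsupp.single x a) = 0 := by
  induction l generalizing u x a with
  | nil => exact absurd rfl h
  | cons e l ih =>
    obtain ⟨rfl, hl⟩ := hl
    rw [LPA.ghostPath_cons, LeftModule.mul_apply]
    by_cases he : (π x).edge 0 = e
    · rw [hB.ghost_apply he]
      refine ih hl (fun h' => h ?_) _
      rw [List.length_cons, DirGraph.InfPath.take_succ, he, ← hB.π_tl, h']
    · rw [hB.ghost_apply_ne he, map_zero]

/-- Hence equality of annihilators forces the itineraries of two systems to begin at the same
vertices, which is how annihilators are compared below. -/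
theorem vert_mem_ann_iff (hB : B.HasItineraries π tl) [Nontrivial A] {w : V} :
    LPA.vert K G w ∈ LeftModule.ann (B.twistedModule wt K) ↔ ∀ x, (π x).src ≠ w := by
  rw [twistedModule_ann_iff]
  refine forall_congr' fun x => ⟨fun h hx => ?_, fun h => hB.vert_apply_ne h 1⟩
  rw [hB.vert_apply hx] at h
  simp at h

end HasItineraries

end BranchingSystem

/-! ### Infinite paths with a lag -/

namespace DirGraph

variable {V E : Type*} {G : DirGraph V E}

theorem infPathSystem_hasItineraries (α : G.InfPath) :
    (infPathSystem α).HasItineraries (fun β => β.1) (fun β => ⟨β.1.tail, β.2.tail⟩) where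
  mem_vset _ _ := Iff.rfl
  mem_eset _ _ := Iff.rfl
  π_tl _ := rfl
  σ_tl x h := by
    refine Subtype.ext (InfPath.ext fun n => ?_)
    cases n <;> rfl

/-- The infinite paths `β` and `γ` have a common tail, which begins at positions that differ by
`k`. -/
def InfPath.TailEquivLag (γ β : G.InfPath) (k : ℤ) : Prop :=
  ∃ m n : ℕ, (m : ℤ) - n = k ∧ β.drop m = γ.drop n

theorem InfPath.TailEquivLag.cons {γ β : G.InfPath} {k : ℤ} (h : γ.TailEquivLag β k) (e : E)
    (he : β.src = G.r e) : γ.TailEquivLag (β.cons e he) (k + 1) := by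
  obtain ⟨m, n, hk, h⟩ := h
  refine ⟨1 + m, n, by push_cast; omega, ?_⟩
  rw [← drop_drop, drop_one]
  exact h

theorem InfPath.TailEquivLag.drop {γ β : G.InfPath} {k : ℤ} (h : γ.TailEquivLag β k) (j : ℕ) :
    γ.TailEquivLag (β.drop j) (k - j) := by
  obtain ⟨m, n, hk, h⟩ := h
  refine ⟨m, n + j, by push_cast; omega, ?_⟩
  rw [← drop_drop γ, ← h, drop_drop, drop_drop, Nat.add_comm]

theorem InfPath.TailEquivLag.tail {γ β : G.InfPath} {k : ℤ} (h : γ.TailEquivLag β k) :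
    γ.TailEquivLag β.tail (k - 1) :=
  drop_one β ▸ h.drop 1

/-- The infinite paths tail equivalent to `γ`, together with a lag. -/
abbrev LagPath (γ : G.InfPath) : Type _ := {z : G.InfPath × ℤ // γ.TailEquivLag z.1 z.2}

/-- The branching system of infinite paths with a lag. -/
def lagSystem (γ : G.InfPath) : BranchingSystem G (LagPath γ) where
  vset v := {z | z.1.1.src = v}
  eset e := {z | z.1.1.edge 0 = e}
  σ e z := ⟨⟨(z.1.1.1.cons e z.2, z.1.1.2 + 1), z.1.2.cons e z.2⟩, rfl⟩
  vset_disjoint v w h := Set.disjoint_left.mpr fun _ h₁ h₂ => h (h₁.symm.trans h₂)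
  eset_disjoint e f h := Set.disjoint_left.mpr fun _ h₁ h₂ => h (h₁.symm.trans h₂)
  eset_subset e _ h := congrArg G.s h
  σ_bijective e := by
    constructor
    · intro z z' h
      refine Subtype.ext (Subtype.ext (Prod.ext (InfPath.ext fun n => ?_) ?_))
      · exact congrArg (fun x => x.1.1.1.edge (n + 1)) h
      · have := congrArg (fun x => x.1.1.2 - 1) h
        simpa using this
    · rintro ⟨⟨⟨β, k⟩, hβ⟩, h⟩
      have h' : β.edge 0 = e := h
      refine ⟨⟨⟨(β.tail, k - 1), hβ.tail⟩, ?_⟩, ?_⟩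
      · change G.s (β.edge 1) = G.r e
        rw [← h', β.valid 0]
      · refine Subtype.ext (Subtype.ext (Prod.ext (InfPath.ext fun n => ?_) ?_))
        · cases n with
          | zero => exact h'.symm
          | succ n => rfl
        · exact sub_add_cancel k 1
  cover v _ := by
    ext z
    simp

/-- Removing the first edge. -/
def LagPath.tail {γ : G.InfPath} (z : LagPath γ) : LagPath γ :=
  ⟨(z.1.1.tail, z.1.2 - 1), z.2.tail⟩

theorem lagSystem_hasItineraries (γ : G.InfPath) :
    (lagSystem γ).HasItineraries (fun z => z.1.1) LagPath.tail where
  mem_vset _ _ := Iff.rfl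
  mem_eset _ _ := Iff.rfl
  π_tl _ := rfl
  σ_tl z h := by
    refine Subtype.ext (Prod.ext (InfPath.ext fun n => ?_) ?_)
    · cases n <;> rfl
    · exact sub_add_cancel z.1.2 1

theorem LagPath.tail_iterate_snd {γ : G.InfPath} (z : LagPath γ) (n : ℕ) :
    (LagPath.tail^[n] z).1.2 = z.1.2 - n := by
  induction n generalizing z with
  | zero => simp
  | succ n ih =>
    rw [Function.iterate_succ_apply, ih]
    change z.1.2 - 1 - (n : ℤ) = _
    push_cast
    ring

/-- The base point of the system of infinite paths with a lag. -/
def LagPath.base (γ : G.InfPath) : LagPath γ := ⟨(γ, 0), 0, 0, by simp, rfl⟩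

end DirGraph

/-! ### Local units and breaking vertices -/

namespace LPA

variable {K V E : Type*} [Field K] {G : DirGraph V E}

/-- Finite sums of vertices are local units on the right: `pq^*` is fixed by the source of `q` and
killed by all other vertices. Membership in an ideal can therefore be tested one vertex at a time.
-/
theorem exists_eq_sum_mul_vert (a : LPA K G) : ∃ S : Finset V, ∀ T, S ⊆ T →
    a = ∑ w ∈ T, a * vert K G w := by
  classical
  obtain ⟨n, ha⟩ := exists_mem_ghostFiltration a
  induction ha using Submodule.span_induction with
  | zero => exact ⟨∅, by simp⟩
  | add a b _ _ ha hb =>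
    obtain ⟨S, hS⟩ := ha
    obtain ⟨S', hS'⟩ := hb
    refine ⟨S ∪ S', fun T hT => ?_⟩
    simp only [add_mul, Finset.sum_add_distrib]
    rw [← hS T (Finset.union_subset_left hT), ← hS' T (Finset.union_subset_right hT)]
  | smul k a _ ha =>
    obtain ⟨S, hS⟩ := ha
    refine ⟨S, fun T hT => ?_⟩
    simp only [smul_mul_assoc, ← Finset.smul_sum]
    rw [← hS T hT]
  | mem a ha =>
    obtain ⟨u, u', w, l, l', -, -, -, rfl⟩ := ha
    refine ⟨{u'}, fun T hT => ?_⟩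
    rw [Finset.sum_eq_single_of_mem u' (Finset.singleton_subset_iff.mp hT), mul_assoc,
      ghostPath_mul_vert]
    intro x _ hx
    rw [← ghostPath_mul_vert, mul_assoc, mul_assoc, vert_mul_ne hx.symm, mul_zero, mul_zero]

theorem mem_of_forall_mul_vert_mem {I : TwoSidedIdeal (LPA K G)} {a : LPA K G}
    (h : ∀ w, a * vert K G w ∈ I) : a ∈ I := by
  obtain ⟨S, hS⟩ := exists_eq_sum_mul_vert a
  rw [hS S subset_rfl]
  exact sum_mem fun w _ => h w

theorem breakingElem_eq {H : Set V} {w : V} (hfin : {e | G.s e = w ∧ G.r e ∉ H}.Finite) :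
    breakingElem K G H w = vert K G w - ∑ e ∈ hfin.toFinset, edge K G e * ghost K G e := by
  rw [breakingElem, finsum_mem_eq_finite_toFinset_sum _ hfin]

/-- If `w` is an infinite emitter, it is a breaking vertex and `w^H` is a generator. Otherwise `w`
is regular, and its defining relation turns `w^H` into the sum of `ee^*` over the edges from `w`
into `H`, each of which factors through a vertex of `H`. -/
theorem breakingElem_mem_idealOf {H : Set V} {w : V} (hw : w ∉ H)
    (hfin : {e | G.s e = w ∧ G.r e ∉ H}.Finite) (hne : {e | G.s e = w ∧ G.r e ∉ H}.Nonempty) :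
    breakingElem K G H w ∈ idealOf K G H (G.breaking H) := by
  classical
  by_cases hinf : G.IsInfiniteEmitter w
  · exact TwoSidedIdeal.subset_span (Or.inr ⟨w, ⟨hinf, hw, hne, hfin⟩, rfl⟩)
  · obtain ⟨f, hf, -⟩ := id hne
    have hreg : G.IsRegular w := ⟨fun h => h f hf, hinf⟩
    have hsub : hfin.toFinset ⊆ (Set.not_infinite.mp hreg.2).toFinset := by
      intro e he
      rw [Set.Finite.mem_toFinset] at he ⊢
      exact he.1
    rw [breakingElem_eq hfin, vert_eq_sum hreg, ← Finset.sum_sdiff hsub, add_sub_cancel_right]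
    refine sum_mem fun e he => ?_
    rw [Finset.mem_sdiff, Set.Finite.mem_toFinset, Set.Finite.mem_toFinset] at he
    have hr : G.r e ∈ H := by
      by_contra hr
      exact he.2 ⟨he.1, hr⟩
    rw [← edge_mul_r]
    refine TwoSidedIdeal.mul_mem_right _ _ _ (TwoSidedIdeal.mul_mem_left _ _ _ ?_)
    exact TwoSidedIdeal.subset_span (Or.inl ⟨_, hr, rfl⟩)

end LPA

/-! ### Annihilator and graded simplicity of the lag system -/

namespace DirGraph

variable {K V E : Type*} [Field K] {G : DirGraph V E} {γ : G.InfPath}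

open BranchingSystem InfPath

theorem lagSystem_path_apply (z : LagPath γ) (n : ℕ) (k : K) :
    (lagSystem γ).module K (LPA.path K G z.1.1.src (z.1.1.take n))
      (Finsupp.single (LagPath.tail^[n] z) k) = Finsupp.single z k := by
  rw [module, (lagSystem_hasItineraries γ).path_apply]
  simp

theorem lagSystem_ghostPath_apply (z : LagPath γ) (n : ℕ) (k : K) :
    (lagSystem γ).module K (LPA.ghostPath K G z.1.1.src (z.1.1.take n)) (Finsupp.single z k) =
      Finsupp.single (LagPath.tail^[n] z) k := by
  rw [module, (lagSystem_hasItineraries γ).ghostPath_apply]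
  simp

/-- A linear combination of paths is determined by its action on a single element. -/
theorem mul_vert_eq_zero_of_pathSpan {b : LPA K G} (hb : b ∈ LPA.pathSpan K G) (z : LagPath γ)
    (h : (lagSystem γ).module K b (Finsupp.single z 1) = 0) :
    b * LPA.vert K G z.1.1.src = 0 := by
  have hγ := lagSystem_hasItineraries γ
  -- This recovers a path from its action on `z`: if `y = pz`, then the lag of `y` exceeds that of
  -- `z` by `|p|`, and `p` consists of the first `|p|` edges of `y`. Without the lag the length of
  -- `p` could not be read off when `z` is eventually periodic.
  let Ψ : (LagPath γ →₀ K) →ₗ[K] LPA K G := Finsupp.linearCombination K fun y =>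
    LPA.path K G y.1.1.src (y.1.1.take (y.1.2 - z.1.2).toNat)
  suffices hΨ : ∀ b ∈ LPA.pathSpan K G,
      Ψ ((lagSystem γ).module K b (Finsupp.single z 1)) = b * LPA.vert K G z.1.1.src by
    rw [← hΨ b hb, h, map_zero]
  intro b hb
  induction hb using Submodule.span_induction with
  | zero => rw [LeftModule.zero_apply, map_zero, zero_mul]
  | add a b _ _ ha hb => rw [LeftModule.add_apply, map_add, ha, hb, add_mul]
  | smul k a _ ha =>
    rw [smul_mul_assoc, ← ha, module, twistedModule_smul, map_smul]
  | mem b hb =>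
    obtain ⟨u, w, l, hl, rfl⟩ := hb
    by_cases hw : w = z.1.1.src
    · subst hw
      obtain ⟨y, rfl, hy, hyz⟩ := hγ.exists_prepend hl
      have hdeg := LagPath.tail_iterate_snd y l.length
      have hact := lagSystem_path_apply (K := K) y l.length 1
      rw [hyz] at hdeg hact
      rw [hy] at hact
      rw [hact, LPA.path_mul_vert hl, Finsupp.linearCombination_single, one_smul,
        show (y.1.2 - z.1.2).toNat = l.length by omega, hy]
    · rw [← LPA.path_mul_vert hl, LeftModule.mul_apply, module,
        hγ.vert_apply_ne (Ne.symm hw), map_zero, map_zero, mul_assoc,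
        LPA.vert_mul_ne hw, mul_zero]

/-- Induction on the ghost length `n`. For every edge `e` the element `ae` has smaller ghost length
and again annihilates the module, so `aee^*` is in the ideal. It remains to express `aw`, modulo the
ideal, through such elements for each vertex `w` outside `H`. -/
theorem lagSystem_mem_idealOf {H : Set V} (hH : ∀ w, w ∈ H ↔ ∀ z : LagPath γ, z.1.1.src ≠ w)
    {n : ℕ} {a : LPA K G} (ha : a ∈ LPA.ghostFiltration K G n)
    (hann : a ∈ LeftModule.ann ((lagSystem γ).module K)) :
    a ∈ LPA.idealOf K G H (G.breaking H) := by
  have hγ := lagSystem_hasItineraries γ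
  have hreach : ∀ {w}, w ∉ H → ∃ z : LagPath γ, z.1.1.src = w := by
    intro w hw
    simpa [hH] using hw
  induction n generalizing a with
  | zero =>
    refine LPA.mem_of_forall_mul_vert_mem fun w => ?_
    by_cases hw : w ∈ H
    · exact TwoSidedIdeal.mul_mem_left _ _ _ (TwoSidedIdeal.subset_span (Or.inl ⟨w, hw, rfl⟩))
    · obtain ⟨z, rfl⟩ := hreach hw
      rw [LPA.ghostFiltration_zero] at ha
      rw [mul_vert_eq_zero_of_pathSpan ha z (LeftModule.mem_ann_iff.mp hann _)]
      exact TwoSidedIdeal.zero_mem _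
  | succ n ih =>
    have hedge : ∀ e, a * (LPA.edge K G e * LPA.ghost K G e) ∈
        LPA.idealOf K G H (G.breaking H) := by
      intro e
      rw [← mul_assoc]
      have hn : a * LPA.edge K G e ∈ LPA.ghostFiltration K G n :=
        Nat.add_sub_cancel n 1 ▸ LPA.mul_edge_mem_ghostFiltration e ha
      exact TwoSidedIdeal.mul_mem_right _ _ _ (ih hn (TwoSidedIdeal.mul_mem_right _ _ _ hann))
    refine LPA.mem_of_forall_mul_vert_mem fun w => ?_
    by_cases hw : w ∈ H
    · exact TwoSidedIdeal.mul_mem_left _ _ _ (TwoSidedIdeal.subset_span (Or.inl ⟨w, hw, rfl⟩))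
    -- With finitely many such edges, `w` is congruent to the sum of their `ee^*`, since `w^H` lies
    -- in the ideal.
    by_cases hfin : {e | G.s e = w ∧ G.r e ∉ H}.Finite
    · have hne : {e | G.s e = w ∧ G.r e ∉ H}.Nonempty := by
        obtain ⟨z, rfl⟩ := hreach hw
        refine ⟨z.1.1.edge 0, rfl, fun h => (hH _).mp h z.tail ?_⟩
        exact hγ.src_tl z
      have hmem := TwoSidedIdeal.mul_mem_left _ a _
        (LPA.breakingElem_mem_idealOf (K := K) hw hfin hne)
      rw [LPA.breakingElem_eq hfin, mul_sub, Finset.mul_sum] at hmem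
      have := TwoSidedIdeal.add_mem _ hmem (sum_mem fun e (_ : e ∈ hfin.toFinset) => hedge e)
      rwa [sub_add_cancel] at this
    -- With infinitely many, split off the path part `b` of `a`. An edge `e` from `w` that avoids
    -- both `S` and `H` satisfies `(a - b)e = 0`.
    · obtain ⟨b, hb, S, hS, h⟩ := LPA.exists_pathSpan_sub w a
      obtain ⟨e, ⟨hew, her⟩, heS⟩ := Set.Infinite.exists_notMem_finset hfin S
      obtain ⟨z', hz'⟩ := hreach her
      obtain ⟨z, hz, rfl⟩ := hγ.exists_cons hz'
      have hsub := h S subset_rfl hS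
      have hzero : (a - b) * LPA.edge K G e = 0 := by
        rw [← LPA.s_mul_edge, hew, ← mul_assoc, hsub, Finset.sum_mul]
        refine Finset.sum_eq_zero fun f hf => ?_
        have hfe : f ≠ e := fun hfe => heS (hfe ▸ hf)
        rw [mul_assoc, mul_assoc, LPA.ghost_mul_edge_ne hfe, mul_zero, mul_zero]
      -- As `be = ae` annihilates the module, `b` kills a path `z` with first edge `e`; being a
      -- combination of paths, `b` then vanishes on `w`.
      have hbw : b * LPA.vert K G w = 0 := by
        have hact : (lagSystem γ).module K b (Finsupp.single z 1) = 0 := by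
          have h₁ := hγ.edge_apply (K := K) (wt := fun _ => (1 : Kˣ)) hz 1
          rw [Units.val_one, mul_one] at h₁
          rw [← h₁]
          change (lagSystem γ).module K b ((lagSystem γ).module K _ _) = 0
          rw [← LeftModule.mul_apply]
          rw [sub_mul, sub_eq_zero] at hzero
          rw [← hzero]
          exact LeftModule.mem_ann_iff.mp (TwoSidedIdeal.mul_mem_right _ _ _ hann) _
        have := mul_vert_eq_zero_of_pathSpan hb z hact
        rwa [InfPath.src, hz, hew] at this
      rw [sub_mul, hbw, sub_zero] at hsub
      rw [hsub]
      refine sum_mem fun f hf => ?_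
      have hbf : b * LPA.edge K G f = 0 := by
        rw [← LPA.s_mul_edge, hS f hf, ← mul_assoc, hbw, zero_mul]
      rw [sub_mul, ← mul_assoc b, hbf, zero_mul, sub_zero]
      exact hedge f

theorem ann_lagSystem {H : Set V} (hH : ∀ w, w ∈ H ↔ ∀ z : LagPath γ, z.1.1.src ≠ w) :
    LeftModule.ann ((lagSystem γ).module K) = LPA.idealOf K G H (G.breaking H) := by
  have hγ := lagSystem_hasItineraries γ
  refine le_antisymm (fun a ha => ?_) (TwoSidedIdeal.span_le.mpr ?_)
  · obtain ⟨n, hn⟩ := LPA.exists_mem_ghostFiltration a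
    exact lagSystem_mem_idealOf hH hn ha
  · rintro _ (⟨w, hw, rfl⟩ | ⟨w, ⟨-, -, -, hfin⟩, rfl⟩)
    · exact hγ.vert_mem_ann_iff.mpr ((hH w).mp hw)
    -- A path that begins at `w` has its first edge among those in the finite sum, because its tail
    -- begins outside `H`. Exactly one summand acts nontrivially, and it fixes the path.
    · refine twistedModule_ann_iff.mpr fun z => ?_
      rw [LPA.breakingElem_eq hfin, LeftModule.sub_apply, LeftModule.sum_apply, sub_eq_zero]
      simp only [LeftModule.mul_apply]
      by_cases hz : z.1.1.src = w
      · rw [hγ.vert_apply hz, Finset.sum_eq_single (z.1.1.edge 0), hγ.ghost_apply rfl,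
          hγ.edge_apply rfl]
        · simp
        · intro e _ he
          rw [hγ.ghost_apply_ne he.symm, map_zero]
        · intro h
          rw [Set.Finite.mem_toFinset] at h
          exact absurd ⟨hz, fun h => (hH _).mp h z.tail (hγ.src_tl z)⟩ h
      · rw [hγ.vert_apply_ne hz, Finset.sum_eq_zero]
        intro e he
        rw [Set.Finite.mem_toFinset] at he
        rw [hγ.ghost_apply_ne, map_zero]
        rintro rfl
        exact hz he.1

variable (K γ) in
/-- The component of degree `n`. -/
noncomputable def lagGrading (n : ℤ) : AddSubgroup (LagPath γ →₀ K) :=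
  (Finsupp.supported K K {z : LagPath γ | z.1.2 = n}).toAddSubgroup

theorem LagPath.exists_iterate_tail_eq (y z : LagPath γ) :
    ∃ m n, LagPath.tail^[m] y = LagPath.tail^[n] z := by
  have hγ := lagSystem_hasItineraries γ
  obtain ⟨a, b, hk, h⟩ := y.2
  obtain ⟨a', b', hk', h'⟩ := z.2
  -- Dropping `a` edges of `y`, respectively `a'` edges of `z`, leaves the tail of `γ` at position
  -- `b`, respectively `b'`. Both are pushed on to position `b + b'`, where the lags agree as well.
  refine ⟨a + b', a' + b, Subtype.ext (Prod.ext ?_ ?_)⟩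
  · refine (hγ.π_iterate _ _).trans (Eq.trans ?_ (hγ.π_iterate _ _).symm)
    rw [← drop_drop, h, ← drop_drop, h', drop_drop, drop_drop, Nat.add_comm]
  · rw [tail_iterate_snd, tail_iterate_snd, ← hk, ← hk']
    push_cast
    ring

/-- A ghost path along a long prefix of one element of the support kills the rest of the support,
and from a single basis element all others are reached through a common tail. Homogeneity is
essential: elements that differ only in the lag cannot be separated by prefixes. -/
theorem lagSystem_eq_top {P : AddSubgroup (LagPath γ →₀ K)}
    (hP : LeftModule.IsSubmodule ((lagSystem γ).module K) P) {n : ℤ} {m : LagPath γ →₀ K}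
    (hmP : m ∈ P) (hmn : m ∈ lagGrading K γ n) (hm : m ≠ 0) : P = ⊤ := by
  classical
  have hγ := lagSystem_hasItineraries γ
  obtain ⟨x, hx⟩ := Finsupp.support_nonempty_iff.mpr hm
  have hdeg : ∀ y ∈ m.support, y.1.2 = n := fun y hy => (Finsupp.mem_supported K m).mp hmn hy
  have hN : ∀ y : LagPath γ, ∃ N, y ∈ m.support → y ≠ x → ∀ k ≥ N,
      y.1.1.take k ≠ x.1.1.take k := by
    intro y
    by_cases h : y ∈ m.support ∧ y ≠ x
    · have hne : y.1.1 ≠ x.1.1 := fun h' =>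
        h.2 (Subtype.ext (Prod.ext h' ((hdeg y h.1).trans (hdeg x hx).symm)))
      obtain ⟨N, hN⟩ : ∃ N, y.1.1.edge N ≠ x.1.1.edge N := by
        by_contra hcon
        push Not at hcon
        exact hne (InfPath.ext hcon)
      exact ⟨N + 1, fun _ _ k hk hk' => hN (take_eq_take hk' hk)⟩
    · exact ⟨0, fun h₁ h₂ => absurd ⟨h₁, h₂⟩ h⟩
  choose N hN using hN
  -- A prefix of this length distinguishes `x` from every other element of the support.
  set k := m.support.sup N
  have hsingle : Finsupp.single (LagPath.tail^[k] x) (m x) ∈ P := by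
    have := hP (LPA.ghostPath K G x.1.1.src (x.1.1.take k)) m hmP
    rwa [← Finsupp.sum_single m, Finsupp.sum, map_sum, Finset.sum_eq_single_of_mem x hx,
      lagSystem_ghostPath_apply] at this
    intro y hy hyx
    refine hγ.ghostPath_apply_ne (isPath_take _ _) ?_ _
    rw [length_take]
    exact hN y hy hyx k (Finset.le_sup hy)
  rw [Finsupp.mem_support_iff] at hx
  rw [eq_top_iff]
  intro m' _
  rw [← Finsupp.sum_single m']
  refine AddSubgroup.sum_mem _ fun y _ => ?_
  obtain ⟨i, j, hij⟩ := LagPath.exists_iterate_tail_eq y (LagPath.tail^[k] x)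
  have hj := hP (LPA.ghostPath K G (LagPath.tail^[k] x).1.1.src ((LagPath.tail^[k] x).1.1.take j)) _
    hsingle
  rw [lagSystem_ghostPath_apply, ← hij] at hj
  -- The subgroup `P` is not assumed closed under scalars, so the coefficient is adjusted by scaling
  -- the element of the algebra.
  have hi := hP ((m' y * (m x)⁻¹) • LPA.path K G y.1.1.src (y.1.1.take i)) _ hj
  rwa [module_smul, lagSystem_path_apply, Finsupp.smul_single, smul_eq_mul, mul_assoc,
    inv_mul_cancel₀ hx, mul_one] at hi

end DirGraph

/-! ### Infinite paths on a cycle -/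

namespace DirGraph

variable {K V E : Type*} [Field K] {G : DirGraph V E}

open BranchingSystem InfPath

section Cycle

variable {c : List E}

theorem IsCycle.edge_eq (hc : G.IsCycle c) {e f : E} (he : e ∈ c) (hf : f ∈ c)
    (h : G.s e = G.s f) : e = f :=
  List.inj_on_of_nodup_map hc.2.2 he hf h

theorem IsCycle.exists_infPath (hc : G.IsCycle c) {v : V} (hv : v ∈ G.cycleVerts c) :
    ∃ γ : G.InfPath, γ.src = v ∧ ∀ n, γ.edge n ∈ c := by
  obtain ⟨e, he, rfl⟩ := hv
  have hnext : ∀ f : {f // f ∈ c}, ∃ g : {g // g ∈ c}, G.s g = G.r f := fun f =>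
    let ⟨g, hg, hgf⟩ := hc.range_mem f.2
    ⟨⟨g, hg⟩, hgf⟩
  choose next hnext using hnext
  refine ⟨⟨fun n => (next^[n] ⟨e, he⟩ : {f // f ∈ c}), fun n => ?_⟩, rfl, fun n =>
    (next^[n] ⟨e, he⟩).2⟩
  rw [Function.iterate_succ_apply', hnext]

theorem IsCycle.infPath_eq (hc : G.IsCycle c) {α β : G.InfPath} (hα : ∀ n, α.edge n ∈ c)
    (hβ : ∀ n, β.edge n ∈ c) (h : α.src = β.src) : α = β := by
  refine InfPath.ext fun n => ?_
  induction n with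
  | zero => exact hc.edge_eq (hα 0) (hβ 0) h
  | succ n ih =>
    refine hc.edge_eq (hα _) (hβ _) ?_
    rw [← α.valid, ← β.valid, ih]

theorem IsCycle.take_eq (hc : G.IsCycle c) {γ : G.InfPath} (hγ : ∀ n, γ.edge n ∈ c) {w : V}
    {l : List E} (hl : G.IsPath γ.src l w) (hlc : ∀ e ∈ l, e ∈ c) : γ.take l.length = l := by
  induction l generalizing γ with
  | nil => rfl
  | cons e l ih =>
    have he : γ.edge 0 = e := hc.edge_eq (hγ 0) (hlc e (by simp)) hl.1.symm
    rw [List.length_cons, take_succ, he]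
    refine congrArg (e :: ·)
      (ih (γ := γ.tail) (fun n => hγ (n + 1)) ?_ fun f hf => hlc f (by simp [hf]))
    have : γ.tail.src = G.r e := by rw [← he, γ.valid 0]; rfl
    rw [this]
    exact hl.2

/-- Rotating `c` to begin with the first edge of `γ` gives a closed path that must be a prefix of
`γ`. After it `γ` is back at its source, and a path on a cycle is determined by its source. -/
theorem IsCycle.drop_length (hc : G.IsCycle c) {γ : G.InfPath} (hγ : ∀ n, γ.edge n ∈ c) :
    γ.drop c.length = γ := by
  obtain ⟨x, hx⟩ := hc.2.1
  obtain ⟨a, b, h⟩ := List.append_of_mem (hγ 0)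
  rw [h] at hx
  obtain ⟨y, hy, hy'⟩ := isPath_append.mp hx
  obtain ⟨rfl, hb⟩ := hy'
  have hl : G.IsPath γ.src ((γ.edge 0 :: b) ++ a) γ.src :=
    isPath_append.mpr ⟨x, ⟨rfl, hb⟩, hy⟩
  have hlen : ((γ.edge 0 :: b) ++ a).length = c.length := by
    rw [h, List.length_append, List.length_append, Nat.add_comm]
  have htake := hc.take_eq hγ hl fun e he => by
    rw [h]
    simp only [List.mem_append] at he ⊢
    exact he.symm
  rw [hlen] at htake
  refine hc.infPath_eq (fun n => hγ _) hγ ?_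
  have := γ.isPath_take c.length
  rw [htake] at this
  exact this.tgt_unique hl

theorem IsCycle.drop_mul_length (hc : G.IsCycle c) {γ : G.InfPath} (hγ : ∀ n, γ.edge n ∈ c)
    (n : ℕ) : γ.drop (n * c.length) = γ := by
  induction n with
  | zero => rw [Nat.zero_mul, drop_zero]
  | succ n ih => rw [Nat.succ_mul, ← drop_drop, ih, hc.drop_length hγ]

theorem IsCycle.length_pos (hc : G.IsCycle c) : 0 < c.length := List.length_pos_iff.mpr hc.1

/-- An infinite path that starts on an exclusive cycle and from all of whose vertices the cycle can
be reached stays on the cycle. -/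
theorem IsExclusive.infPath_mem (hc : G.IsExclusive c) {α : G.InfPath}
    (h₀ : α.src ∈ G.cycleVerts c) (h : ∀ n, G.s (α.edge n) ∈ G.root (G.cycleVerts c)) (n : ℕ) :
    α.edge n ∈ c := by
  -- The cycle can be reached again from the range of this edge, and exclusivity leaves only edges
  -- of `c` for such a return.
  have key : ∀ n, G.s (α.edge n) ∈ G.cycleVerts c → α.edge n ∈ c := by
    intro n hn
    obtain ⟨w, hw, l, hl⟩ := h (n + 1)
    rw [← α.valid n] at hl
    exact hc.edge_mem hn hl hw
  induction n with
  | zero => exact key 0 h₀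
  | succ n ih => exact key _ (α.valid n ▸ hc.1.range_mem ih)

/-- A path into the cycle can be continued along it to the source of `γ` and then prepended to `γ`.
Conversely, a path tail equivalent to `γ` eventually runs on the cycle. -/
theorem mem_root_iff (hc : G.IsCycle c) {γ : G.InfPath} (hγ : ∀ n, γ.edge n ∈ c) {w : V} :
    w ∈ G.root (G.cycleVerts c) ↔ ∃ z : LagPath γ, z.1.1.src = w := by
  constructor
  · rintro ⟨u, hu, l, hl⟩
    obtain ⟨l', hl'⟩ := hc.exists_path hu ⟨γ.edge 0, hγ 0, rfl⟩
    obtain ⟨z, hz, -⟩ := (lagSystem_hasItineraries γ).exists_prepend (x := LagPath.base γ)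
      (isPath_append.mpr ⟨u, hl, hl'⟩)
    exact ⟨z, hz⟩
  · rintro ⟨⟨⟨β, k⟩, m, n, -, h⟩, rfl⟩
    refine ⟨_, ?_, _, β.isPath_take m⟩
    rw [show β.drop m = γ.drop n from h]
    exact ⟨_, hγ _, rfl⟩

theorem IsExclusive.lagPath_eq (hc : G.IsExclusive c) {γ : G.InfPath} (hγ : ∀ n, γ.edge n ∈ c)
    (z : LagPath γ) (hz : z.1.1.src ∈ G.cycleVerts c) (n : ℕ) : z.1.1.edge n ∈ c :=
  hc.infPath_mem hz (fun n => (mem_root_iff hc.1 hγ).mpr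
    ⟨⟨(z.1.1.drop n, z.1.2 - n), z.2.drop n⟩, rfl⟩) n

end Cycle

/-! ### Reduced elements `pq^*` as infinite paths with a lag -/

section Equivalence

variable {c : List E} {v : V}

/-- The element `z` is the infinite path `pγ'` with lag `|p| - |q|`, where `γ = qγ'`. -/
def YElem.Represents {γ : G.InfPath} (y : G.YElem c v) (z : LagPath γ) : Prop :=
  z.1.2 = y.deg ∧ z.1.1.take y.p.length = y.p ∧ z.1.1.drop y.p.length = γ.drop y.q.length

theorem YElem.Represents.unique {γ : G.InfPath} {y : G.YElem c v} {z z' : LagPath γ}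
    (h : y.Represents z) (h' : y.Represents z') : z = z' :=
  Subtype.ext (Prod.ext (eq_of_take_drop (h.2.1.trans h'.2.1.symm) (h.2.2.trans h'.2.2.symm))
    (h.1.trans h'.1.symm))

theorem YElem.take_q (hc : G.IsExclusive c) (hv : v ∈ G.cycleVerts c) {γ : G.InfPath}
    (hγv : γ.src = v) (hγ : ∀ n, γ.edge n ∈ c) (y : G.YElem c v) :
    γ.take y.q.length = y.q := by
  subst hγv
  exact hc.1.take_eq hγ y.hq (hc.edges_mem hv y.hq y.hmid)

theorem YElem.Represents.src_eq {γ : G.InfPath} {y : G.YElem c v} {z : LagPath γ}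
    (hγ : γ.take y.q.length = y.q) (hγv : γ.src = v) (h : y.Represents z) : z.1.1.src = y.src := by
  have h₁ := γ.isPath_take y.q.length
  rw [hγ, hγv] at h₁
  have h₂ := z.1.1.isPath_take y.p.length
  rw [h.2.1, h.2.2, h₁.tgt_unique y.hq] at h₂
  have h₃ := y.hp
  revert h₂ h₃
  cases y.p with
  | nil => exact fun h h' => Eq.trans h h'.symm
  | cons e l => exact fun h h' => h.1.symm.trans h'.1

theorem YElem.exists_represents (hc : G.IsExclusive c) (hv : v ∈ G.cycleVerts c) {γ : G.InfPath}
    (hγv : γ.src = v) (hγ : ∀ n, γ.edge n ∈ c) (y : G.YElem c v) :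
    ∃ z : LagPath γ, y.Represents z := by
  have h₁ := γ.isPath_take y.q.length
  rw [y.take_q hc hv hγv hγ, hγv] at h₁
  obtain ⟨β, -, h₂, h₃⟩ := InfPath.exists_prepend (γ.drop y.q.length)
    ((h₁.tgt_unique y.hq).symm ▸ y.hp)
  exact ⟨⟨(β, y.deg), _, _, rfl, h₃⟩, rfl, h₂, h₃⟩

/-- Since `γ` begins with `qt`, writing `γ = qtγ''` gives the same infinite path `ptγ''` from both
pairs, and the lengths change equally. So an element of `Y^v` and its reduction represent the same
point. -/
theorem YElem.Represents.of_append {γ : G.InfPath} {x y : G.YElem c v} {t : List E} {z : LagPath γ}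
    (hγ : γ.take y.q.length = y.q) (hp : y.p = x.p ++ t) (hq : y.q = x.q ++ t)
    (h : x.Represents z) : y.Represents z := by
  have ht : (γ.drop x.q.length).take t.length = t := by
    rw [hq, List.length_append, take_add] at hγ
    exact (List.append_inj hγ (by simp)).2
  refine ⟨?_, ?_, ?_⟩
  · rw [h.1, deg, deg, hp, hq]
    simp
  · rw [hp, List.length_append, take_add, h.2.1, h.2.2, ht]
  · rw [hp, hq, List.length_append, List.length_append, ← drop_drop, h.2.2, drop_drop]

theorem YElem.Represents.eq_of_noCommonEnd {γ : G.InfPath} {x y : G.YElem c v} {z : LagPath γ}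
    (hγ : ∀ y : G.YElem c v, γ.take y.q.length = y.q) (hx : x.Represents z) (hy : y.Represents z)
    (hxn : NoCommonEnd x.p x.q) (hyn : NoCommonEnd y.p y.q) : x = y := by
  wlog hle : x.p.length ≤ y.p.length generalizing x y
  · exact (this hy hx hyn hxn (by omega)).symm
  -- Equal lags mean that `q` grows by the same `d` as `p`. The longer pair arises from the shorter
  -- one by appending one segment of `γ` to both components, and having no common end forces this
  -- segment to be trivial.
  obtain ⟨d, hd⟩ := Nat.exists_eq_add_of_le hle
  have hdeg : x.deg = y.deg := hx.1.symm.trans hy.1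
  have hd' : y.q.length = x.q.length + d := by
    rw [deg, deg] at hdeg
    omega
  have hp : y.p = x.p ++ (γ.drop x.q.length).take d := by
    rw [← hy.2.1, hd, take_add, hx.2.1, hx.2.2]
  have hq : y.q = x.q ++ (γ.drop x.q.length).take d := by
    rw [← hγ y, hd', take_add, hγ x]
  rw [hp, hq] at hyn
  rw [hyn.eq_nil, List.append_nil] at hp hq
  exact ext_of_edges hp.symm hq.symm

/-- The branching system `X^v` is the system of infinite paths, with a lag, that are tail equivalent
to `ccc…`. -/
theorem exists_equiv_lagPath (hc : G.IsExclusive c) (hv : v ∈ G.cycleVerts c) {γ : G.InfPath}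
    (hγv : γ.src = v) (hγ : ∀ n, γ.edge n ∈ c) :
    ∃ Φ : G.XElem c v ≃ LagPath γ, IsMorphism (exclusiveSystem hc hv) (lagSystem γ) Φ ∧
      ∀ x, (Φ x).1.2 = x.1.deg := by
  have htake := YElem.take_q hc hv hγv hγ
  choose Ψ hΨ using YElem.exists_represents hc hv hγv hγ
  have hred : ∀ y, Ψ y.red = Ψ y := by
    intro y
    obtain ⟨-, t, hp, hq⟩ := y.red_spec
    exact ((hΨ y.red).of_append (htake y) hp hq).unique (hΨ y)
  have hinj : Function.Injective fun x : G.XElem c v => Ψ x.1 := fun x y hxy =>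
    Subtype.ext ((hΨ x.1).eq_of_noCommonEnd htake ((show Ψ x.1 = Ψ y.1 from hxy) ▸ hΨ y.1)
      (YElem.noCommonEnd_of_red_eq hc hv x.2) (YElem.noCommonEnd_of_red_eq hc hv y.2))
  have hsurj : Function.Surjective fun x : G.XElem c v => Ψ x.1 := by
    intro z
    obtain ⟨m, n, hk, h⟩ := z.2
    have hz := z.1.1.isPath_take m
    rw [h] at hz
    -- The preimage is the reduction of `pq^*`, with `p` the first `m` edges of `z` and `q` the
    -- first `n` edges of `γ`; both end where the common tail begins.
    let y : G.YElem c v := ⟨_, _, _, _, hz, hγv ▸ γ.isPath_take n, γ.edge n, hγ n, rfl⟩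
    refine ⟨⟨y.red, YElem.red_red hc hv y⟩, (hred y).trans ((hΨ y).unique ⟨?_, ?_, ?_⟩)⟩
    · simp [YElem.deg, y, hk]
    · simp [y]
    · simpa [y] using h
  have hsrc : ∀ y, (Ψ y).1.1.src = y.src := fun y => (hΨ y).src_eq (htake y) hγv
  have hσ : ∀ e (x : G.YElem c v) h h',
      Ψ (x.cons e h).red = ((lagSystem γ).σ e ⟨Ψ x, h'⟩ : LagPath γ) := by
    intro e x h h'
    rw [hred]
    refine (hΨ _).unique ⟨?_, ?_, ?_⟩
    · change (Ψ x).1.2 + 1 = ((e :: x.p).length : ℤ) - x.q.length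
      rw [(hΨ x).1, YElem.deg, List.length_cons]
      push_cast
      ring
    · change InfPath.take _ (x.p.length + 1) = e :: x.p
      rw [take_succ]
      exact congrArg (e :: ·) (hΨ x).2.1
    · change InfPath.drop _ (x.p.length + 1) = γ.drop x.q.length
      rw [Nat.add_comm, ← drop_drop, drop_one]
      exact (hΨ x).2.2
  refine ⟨Equiv.ofBijective _ ⟨hinj, hsurj⟩, ⟨fun w x => ?_, fun e x => ?_, fun e x h h' => ?_⟩,
    fun x => (hΨ x.1).1⟩
  · change (Ψ x.1).1.1.src = w ↔ x.1.src = w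
    rw [hsrc]
  · constructor
    · intro h
      have h₀ : (Ψ x.1).1.1.edge 0 = e := h
      -- A path with first edge `e` is `σ_e` of its tail. Lifting the tail to some `y` and using
      -- injectivity shows that `x` is the reduction of `ey`.
      obtain ⟨y, hy⟩ := hsurj (Ψ x.1).tail
      have hy' : Ψ y.1 = (Ψ x.1).tail := hy
      have hs : (Ψ y.1).1.1.src = G.r e := by
        rw [hy', ← h₀]
        exact (lagSystem_hasItineraries γ).src_tl (Ψ x.1)
      have hm : y.1.src = G.r e := (hsrc y.1).symm.trans hs
      refine ⟨y.1, hm, ?_⟩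
      have h₁ := hσ e y.1 hm hs
      have h₂ : ((lagSystem γ).σ e ⟨Ψ y.1, hs⟩ : LagPath γ) = Ψ x.1 := by
        subst h₀
        have := (lagSystem_hasItineraries γ).σ_tl (Ψ x.1) (hy' ▸ hs)
        simpa only [hy'] using this
      exact congrArg Subtype.val (@hinj x ⟨_, YElem.red_red hc hv _⟩ (h₂.symm.trans h₁.symm))
    · rintro ⟨y, h, hx⟩
      change (Ψ x.1).1.1.edge 0 = e
      rw [hx, hσ e y h ((hsrc y).trans h)]
      rfl
  · exact hσ e x.1 h h'

end Equivalence

end DirGraph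

/-! ### Transport along graded isomorphisms and change of the reference path -/

theorem BranchingSystem.IsMorphism.gradedIsomorphic {K V E X X' : Type*} [Field K]
    {G : DirGraph V E} {B : BranchingSystem G X} {B' : BranchingSystem G X'} (Φ : X ≃ X')
    (hΦ : IsMorphism B B' Φ) {deg : X → ℤ} {deg' : X' → ℤ} (hdeg : ∀ x, deg' (Φ x) = deg x) :
    LeftModule.GradedIsomorphic (B.module K)
      (fun n => (Finsupp.supported K K {x | deg x = n}).toAddSubgroup) (B'.module K)
      (fun n => (Finsupp.supported K K {x | deg' x = n}).toAddSubgroup) := by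
  refine ⟨Finsupp.domCongr Φ, fun a m => ?_, fun n m => ?_⟩
  · simp only [Finsupp.domCongr_apply, Finsupp.equivMapDomain_eq_mapDomain]
    exact hΦ.map_module a m
  · rw [Submodule.mem_toAddSubgroup, Submodule.mem_toAddSubgroup, Finsupp.mem_supported',
      Finsupp.mem_supported', Finsupp.domCongr_apply]
    constructor
    · intro h x hx
      rw [Finsupp.equivMapDomain_apply]
      refine h _ fun hx' => hx ?_
      rw [Set.mem_ofPred_eq] at hx' ⊢
      rw [← hx', ← hdeg, Φ.apply_symm_apply]
    · intro h x hx
      have := h (Φ x) fun hx' => hx ((hdeg x).symm.trans hx')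
      rwa [Finsupp.equivMapDomain_apply, Φ.symm_apply_apply] at this

/-- A nonzero graded submodule contains a nonzero homogeneous element, so it suffices that every
such element generates the whole module. -/
theorem LeftModule.GradedIsomorphic.isGradedSimple {R M N : Type*} [NonUnitalRing R]
    [AddCommGroup M] [AddCommGroup N] {ρ : LeftModule R M} {ℳ : ℤ → AddSubgroup M}
    {τ : LeftModule R N} {𝒩 : ℤ → AddSubgroup N} (h : GradedIsomorphic ρ ℳ τ 𝒩) [Nontrivial N]
    (hτ : ∀ P, IsSubmodule τ P → ∀ n, ∀ m ∈ P, m ∈ 𝒩 n → m ≠ 0 → P = ⊤) :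
    IsGradedSimple ρ ℳ := by
  obtain ⟨φ, hφ, hd⟩ := h
  refine ⟨φ.toEquiv.nontrivial, fun P hP hsum => ?_⟩
  by_cases hbot : ∀ n, P ⊓ ℳ n = ⊥
  · left
    rw [hsum]
    simp [hbot]
  · right
    push Not at hbot
    obtain ⟨n, hn⟩ := hbot
    obtain ⟨m, hm, hm₀⟩ := (P ⊓ ℳ n).bot_or_exists_ne_zero.resolve_left hn
    have htop := hτ (P.map φ.toAddMonoidHom) ?_ n (φ m) ⟨m, hm.1, rfl⟩ ((hd n _).mp hm.2)
      (by rwa [Ne, φ.map_eq_zero_iff])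
    · rw [eq_top_iff]
      intro x _
      obtain ⟨y, hy, hyx⟩ := (htop ▸ AddSubgroup.mem_top (φ x) : φ x ∈ P.map φ.toAddMonoidHom)
      rwa [← φ.injective hyx]
    · rintro a _ ⟨y, hy, rfl⟩
      exact ⟨ρ a y, hP a y hy, hφ a y⟩

namespace DirGraph

variable {K V E : Type*} [Field K] {G : DirGraph V E}

open BranchingSystem InfPath

theorem YElem.deg_red {c : List E} {v : V} (y : G.YElem c v) : y.red.deg = y.deg := by
  obtain ⟨-, t, hp, hq⟩ := y.red_spec
  have hp' := congrArg List.length hp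
  have hq' := congrArg List.length hq
  rw [List.length_append] at hp' hq'
  rw [deg, deg]
  omega

theorem exclusiveSystem_deg_σ {c : List E} {v : V} (hc : G.IsExclusive c)
    (hv : v ∈ G.cycleVerts c) (e : E) (x : (exclusiveSystem hc hv).vset (G.r e)) :
    ((exclusiveSystem hc hv).σ e x).1.1.deg = x.1.1.deg + 1 := by
  change ((x.1.1.cons e x.2).red).deg = _
  rw [YElem.deg_red]
  change ((e :: x.1.1.p).length : ℤ) - x.1.1.q.length = x.1.1.p.length - x.1.1.q.length + 1
  rw [List.length_cons]
  push_cast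
  ring

/-- Forgetting the lag. -/
def LagPath.forget {γ : G.InfPath} (z : LagPath γ) : {β : G.InfPath // γ.TailEquiv β} :=
  ⟨z.1.1, let ⟨m, n, _, h⟩ := z.2
    ⟨n, m, fun k => (congrArg (fun β => β.edge k) h).symm⟩⟩

theorem forget_isMorphism (γ : G.InfPath) :
    IsMorphism (lagSystem γ) (infPathSystem γ) LagPath.forget where
  mem_vset _ _ := Iff.rfl
  mem_eset _ _ := Iff.rfl
  map_σ _ _ _ _ := rfl

theorem InfPath.tailEquivLag_drop_iff {γ β : G.InfPath} {k : ℤ} (n : ℕ) :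
    (γ.drop n).TailEquivLag β (k + n) ↔ γ.TailEquivLag β k := by
  constructor
  · rintro ⟨a, b, hk, h⟩
    rw [drop_drop] at h
    exact ⟨a, n + b, by push_cast; omega, h⟩
  · rintro ⟨a, b, hk, h⟩
    refine ⟨a + n, b, by push_cast; omega, ?_⟩
    rw [drop_drop, ← drop_drop, h, drop_drop, Nat.add_comm]

/-- Changing the reference path to one of its tails. -/
def lagPathDropEquiv (γ : G.InfPath) (n : ℕ) : LagPath γ ≃ LagPath (γ.drop n) where
  toFun z := ⟨(z.1.1, z.1.2 + n), (tailEquivLag_drop_iff n).mpr z.2⟩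
  invFun z := ⟨(z.1.1, z.1.2 - n), (tailEquivLag_drop_iff n).mp (by
    rw [sub_add_cancel]
    exact z.2)⟩
  left_inv z := Subtype.ext (Prod.ext rfl (add_sub_cancel_right _ _))
  right_inv z := Subtype.ext (Prod.ext rfl (sub_add_cancel _ _))

theorem lagPathDropEquiv_isMorphism (γ : G.InfPath) (n : ℕ) :
    IsMorphism (lagSystem γ) (lagSystem (γ.drop n)) (lagPathDropEquiv γ n) where
  mem_vset _ _ := Iff.rfl
  mem_eset _ _ := Iff.rfl
  map_σ _ _ _ _ := Subtype.ext (Prod.ext rfl (add_right_comm _ _ _))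

theorem lagSystem_gradedIsomorphic_drop (γ : G.InfPath) (n : ℕ) :
    LeftModule.GradedIsomorphic ((lagSystem γ).module K) (lagGrading K γ)
      ((lagSystem (γ.drop n)).module K) (LeftModule.shift (lagGrading K (γ.drop n)) n) := by
  -- The target is graded by the lag minus `n`, so its component of degree `k` is the component of
  -- lag `k + n`, as in the shifted module.
  have h := IsMorphism.gradedIsomorphic (K := K) (lagPathDropEquiv γ n)
    (lagPathDropEquiv_isMorphism γ n) (deg := fun z => z.1.2) (deg' := fun z => z.1.2 - n)
    fun z => add_sub_cancel_right _ _
  simp only [sub_eq_iff_eq_add] at h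
  exact h

theorem lagSystem_vert_apply_mem {γ : G.InfPath} (w : V) (m : LagPath γ →₀ K) :
    (lagSystem γ).module K (LPA.vert K G w) m ∈
      Finsupp.supported K K {z : LagPath γ | z.1.1.src = w} := by
  have hγ := lagSystem_hasItineraries γ
  refine map_mem_supported (s := Set.univ) (fun z _ k => ?_) (by rw [Finsupp.supported_univ]; trivial)
  by_cases hz : z.1.1.src = w
  · rw [module, hγ.vert_apply hz]
    exact Finsupp.single_mem_supported K k hz
  · rw [module, hγ.vert_apply_ne hz]
    exact Submodule.zero_mem _

/-- The path `γ` with lag `0` is homogeneous of degree `0` and fixed by its source. Its image is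
nonzero with the same two properties, so any element of the support of the image will do. -/
theorem exists_lagPath_of_gradedIsomorphic {γ δ : G.InfPath}
    (h : LeftModule.GradedIsomorphic ((lagSystem γ).module K) (lagGrading K γ)
      ((lagSystem δ).module K) (lagGrading K δ)) :
    ∃ z : LagPath δ, z.1.2 = 0 ∧ z.1.1.src = γ.src := by
  obtain ⟨φ, hφ, hdeg⟩ := h
  have hmdeg : Finsupp.single (LagPath.base γ) 1 ∈ lagGrading K γ 0 :=
    Finsupp.single_mem_supported K 1 (show (LagPath.base γ).1.2 = 0 from rfl)
  have hmv : (lagSystem γ).module K (LPA.vert K G γ.src) (Finsupp.single (LagPath.base γ) 1) =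
      Finsupp.single (LagPath.base γ) 1 := by
    rw [module, (lagSystem_hasItineraries γ).vert_apply 
      (show (LagPath.base γ).1.1.src = γ.src from rfl)]
  have hm₀ : φ (Finsupp.single (LagPath.base γ) 1) ≠ 0 := by
    rw [Ne, φ.map_eq_zero_iff]
    simp
  obtain ⟨z, hz⟩ := Finsupp.support_nonempty_iff.mpr hm₀
  have hz₀ := (Finsupp.mem_supported K _).mp ((hdeg 0 _).mp hmdeg) hz
  refine ⟨z, hz₀, ?_⟩
  have := lagSystem_vert_apply_mem (K := K) γ.src (φ (Finsupp.single (LagPath.base γ) 1))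
  rw [← hφ, hmv] at this
  exact (Finsupp.mem_supported K _).mp this hz

/-! ### Structure and isomorphism classes of the modules `N_c^v` -/

section Exclusive

variable {c : List E} {v : V} (hc : G.IsExclusive c) (hv : v ∈ G.cycleVerts c)

theorem exclusiveModule_gradedIsomorphic {γ : G.InfPath} (hγv : γ.src = v)
    (hγ : ∀ n, γ.edge n ∈ c) :
    LeftModule.GradedIsomorphic (exclusiveModule K hc hv) (exclusiveGrading K G c v)
      ((lagSystem γ).module K) (lagGrading K γ) := by
  obtain ⟨Φ, hΦ, hdeg⟩ := exists_equiv_lagPath hc hv hγv hγ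
  exact hΦ.gradedIsomorphic (deg := fun x => x.1.deg) (deg' := fun z => z.1.2) Φ hdeg

theorem ann_exclusiveModule_eq {γ : G.InfPath} (hγv : γ.src = v) (hγ : ∀ n, γ.edge n ∈ c) :
    LeftModule.ann (exclusiveModule K hc hv) = LeftModule.ann ((lagSystem γ).module K) :=
  (exclusiveModule_gradedIsomorphic hc hv hγv hγ).isomorphic.ann_eq

theorem vert_mem_ann_exclusiveModule {w : V} :
    LPA.vert K G w ∈ LeftModule.ann (exclusiveModule K hc hv) ↔
      w ∉ G.root (G.cycleVerts c) := by
  obtain ⟨γ, hγv, hγ⟩ := hc.1.exists_infPath hv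
  rw [ann_exclusiveModule_eq hc hv hγv hγ, mem_root_iff hc.1 hγ, not_exists]
  exact (lagSystem_hasItineraries γ).vert_mem_ann_iff

theorem ann_exclusiveModule {H : Set V} (hH : H = (G.root (G.cycleVerts c))ᶜ) :
    LeftModule.ann (exclusiveModule K hc hv) = LPA.idealOf K G H (G.breaking H) := by
  obtain ⟨γ, hγv, hγ⟩ := hc.1.exists_infPath hv
  rw [ann_exclusiveModule_eq hc hv hγv hγ]
  refine ann_lagSystem fun w => ?_
  rw [hH, Set.mem_compl_iff, mem_root_iff hc.1 hγ, not_exists]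

theorem exclusiveModule_isGraded :
    LeftModule.IsGraded (LPA.grading K G) (exclusiveModule K hc hv) (exclusiveGrading K G c v) :=
  ⟨Finsupp.isInternal_supported_fiber _, fun _ _ _ ha _ hm =>
    module_grading_mem (exclusiveSystem_deg_σ hc hv) ha hm⟩

theorem exclusiveModule_isGradedSimple :
    LeftModule.IsGradedSimple (exclusiveModule K hc hv) (exclusiveGrading K G c v) := by
  obtain ⟨γ, hγv, hγ⟩ := hc.1.exists_infPath hv
  have : Nonempty (LagPath γ) := ⟨LagPath.base γ⟩
  exact (exclusiveModule_gradedIsomorphic hc hv hγv hγ).isGradedSimple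
    fun P hP n m hm hmn hm₀ => lagSystem_eq_top hP hm hmn hm₀

/-- Forgetting the lag is a homomorphism to the Chen module of `γ`; it is nonzero, and it is not
injective because `γ` is periodic. -/
theorem exclusiveModule_not_isSimple : ¬ LeftModule.IsSimple (exclusiveModule K hc hv) := by
  obtain ⟨γ, hγv, hγ⟩ := hc.1.exists_infPath hv
  obtain ⟨φ, hφ⟩ := (exclusiveModule_gradedIsomorphic (K := K) hc hv hγv hγ).isomorphic
  let ψ : (LagPath γ →₀ K) →+ ({β : G.InfPath // γ.TailEquiv β} →₀ K) :=
    Finsupp.mapDomain.addMonoidHom LagPath.forget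
  refine LeftModule.not_isSimple_of_hom (τ := (infPathSystem γ).module K)
    (ψ.comp φ.toAddMonoidHom) (fun a m => ?_) (fun h => ?_) (fun h => ?_)
  · change Finsupp.mapDomain _ (φ (exclusiveModule K hc hv a m)) = _
    rw [hφ, (forget_isMorphism γ).map_module]
    rfl
  · have h₁ := DFunLike.congr_fun h (φ.symm (Finsupp.single (LagPath.base γ) 1))
    change Finsupp.mapDomain _ (φ (φ.symm _)) = 0 at h₁
    rw [φ.apply_symm_apply, Finsupp.mapDomain_single] at h₁
    simp at h₁
  -- The path `cγ = γ` with lag `|c|` has the same image as `γ` with lag `0`.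
  · let z : LagPath γ := ⟨(γ, c.length), c.length, 0, by simp, by
      rw [hc.1.drop_length hγ, drop_zero]⟩
    have h₁ : φ.symm (Finsupp.single (LagPath.base γ) 1) = φ.symm (Finsupp.single z 1) := by
      apply h
      change Finsupp.mapDomain _ (φ (φ.symm _)) = Finsupp.mapDomain _ (φ (φ.symm _))
      rw [φ.apply_symm_apply, φ.apply_symm_apply, Finsupp.mapDomain_single,
        Finsupp.mapDomain_single]
      rfl
    have h₂ := Finsupp.single_left_injective one_ne_zero (φ.symm.injective h₁)
    have h₃ : (0 : ℤ) = c.length := congrArg (fun z => z.1.2) h₂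
    have := hc.1.length_pos
    omega

theorem exclusiveModule_gradedIsomorphic_shift {w : V} (hw : w ∈ G.cycleVerts c) {l : List E}
    (hl : G.IsPath v l w) (hlc : ∀ e ∈ l, e ∈ c) :
    LeftModule.GradedIsomorphic
      (exclusiveModule K hc hv) (exclusiveGrading K G c v)
      (exclusiveModule K hc hw) (LeftModule.shift (exclusiveGrading K G c w) l.length) := by
  obtain ⟨γ, rfl, hγ⟩ := hc.1.exists_infPath hv
  have hsrc : (γ.drop l.length).src = w := by
    have := γ.isPath_take l.length
    rw [hc.1.take_eq hγ hl hlc] at this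
    exact this.tgt_unique hl
  have h := exclusiveModule_gradedIsomorphic (K := K) hc hw hsrc fun n => hγ _
  exact (exclusiveModule_gradedIsomorphic hc hv rfl hγ).trans
    ((lagSystem_gradedIsomorphic_drop γ l.length).trans (h.shift _).symm)

theorem _root_.List.IsRotated.cycleVerts_eq {c d : List E} (h : c ~r d) :
    G.cycleVerts c = G.cycleVerts d := by
  ext v
  simp only [cycleVerts, Set.mem_ofPred_eq, h.mem_iff]

theorem exclusiveModule_gradedIsomorphic_of_isRotated {d : List E} (hd : G.IsExclusive d)
    (hw : v ∈ G.cycleVerts d) (h : c ~r d) :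
    LeftModule.GradedIsomorphic (exclusiveModule K hc hv) (exclusiveGrading K G c v)
      (exclusiveModule K hd hw) (exclusiveGrading K G d v) := by
  obtain ⟨γ, hγv, hγ⟩ := hc.1.exists_infPath hv
  exact (exclusiveModule_gradedIsomorphic hc hv hγv hγ).trans
    (exclusiveModule_gradedIsomorphic hd hw hγv fun n => h.mem_iff.mp (hγ n)).symm

theorem exclusiveModule_isomorphic_of_isRotated {d : List E} (hd : G.IsExclusive d) {w : V}
    (hw : w ∈ G.cycleVerts d) (h : c ~r d) :
    LeftModule.Isomorphic (exclusiveModule K hc hv) (exclusiveModule K hd hw) := by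
  have hw' : w ∈ G.cycleVerts c := h.cycleVerts_eq ▸ hw
  obtain ⟨l, hl⟩ := hc.1.exists_path hv hw'
  exact (exclusiveModule_gradedIsomorphic_shift hc hv hw' hl
    (hc.edges_mem hv hl hw')).isomorphic.trans
    (exclusiveModule_gradedIsomorphic_of_isRotated hc hw' hd hw h).isomorphic

theorem IsCycle.mem_cycleVerts_of_isPath (hc : G.IsCycle c) {u w : V} {l : List E}
    (hu : u ∈ G.cycleVerts c) (hl : G.IsPath u l w) (hlc : ∀ e ∈ l, e ∈ c) :
    w ∈ G.cycleVerts c := by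
  induction l generalizing u with
  | nil => exact (show u = w from hl) ▸ hu
  | cons e l ih =>
    exact ih (hc.range_mem (hlc e (by simp))) hl.2 fun f hf => hlc f (by simp [hf])

/-- A path that leaves `c` and comes back to it consists of edges of `c`, so its intermediate
vertices are on `c`. -/
theorem IsExclusive.mem_cycleVerts (hc : G.IsExclusive c) {u w : V} {l : List E}
    (hu : u ∈ G.cycleVerts c) (hl : G.IsPath u l w) (hw : w ∈ G.root (G.cycleVerts c)) :
    w ∈ G.cycleVerts c := by
  obtain ⟨x, hx, l', hl'⟩ := hw
  have := hc.edges_mem hu (isPath_append.mpr ⟨w, hl, hl'⟩) hx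
  exact hc.1.mem_cycleVerts_of_isPath hu hl fun e he => this e (by simp [he])

theorem cycleVerts_subset_root : G.cycleVerts c ⊆ G.root (G.cycleVerts c) :=
  fun w hw => ⟨w, hw, [], rfl⟩

/-- Equal annihilators give equal roots. Then some path from `v` reaches a vertex `u` of `d`, and
`c` can be reached from `u`; so `u` lies on `c` as well, and exclusivity identifies the cycles. -/
theorem isRotated_of_ann_eq {d : List E} (hd : G.IsExclusive d) {w : V}
    (hw : w ∈ G.cycleVerts d)
    (h : LeftModule.ann (exclusiveModule K hc hv) = LeftModule.ann (exclusiveModule K hd hw)) :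
    c ~r d := by
  have hroot : ∀ u, u ∈ G.root (G.cycleVerts c) ↔ u ∈ G.root (G.cycleVerts d) := by
    intro u
    rw [← not_iff_not, ← vert_mem_ann_exclusiveModule (K := K) hc hv, h,
      vert_mem_ann_exclusiveModule]
  obtain ⟨u, hu, l, hl⟩ := (hroot v).mp (cycleVerts_subset_root hv)
  exact hc.2 d hd.1
    ⟨u, hc.mem_cycleVerts hv hl ((hroot u).mpr (cycleVerts_subset_root hu)), hu⟩

theorem eq_of_gradedIsomorphic {d : List E} (hd : G.IsExclusive d) {w : V}
    (hw : w ∈ G.cycleVerts d) (hcd : c ~r d)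
    (h : LeftModule.GradedIsomorphic (exclusiveModule K hc hv) (exclusiveGrading K G c v)
      (exclusiveModule K hd hw) (exclusiveGrading K G d w)) : v = w := by
  obtain ⟨γ, rfl, hγ⟩ := hc.1.exists_infPath hv
  obtain ⟨δ, rfl, hδ⟩ := hd.1.exists_infPath hw
  have hδc : ∀ n, δ.edge n ∈ c := fun n => hcd.mem_iff.mpr (hδ n)
  obtain ⟨z, hz₀, hzv⟩ := exists_lagPath_of_gradedIsomorphic
    ((exclusiveModule_gradedIsomorphic hc hv rfl hγ).symm.trans
      (h.trans (exclusiveModule_gradedIsomorphic hd hw rfl hδ)))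
  have hzc := hc.lagPath_eq hδc z (hzv ▸ hv)
  obtain ⟨a, b, hk, hab⟩ := z.2
  -- Lag zero means that `z` and `δ` agree after dropping the same number of edges. Raising this
  -- number to a multiple of the period `|c|` restores both paths, so they coincide.
  obtain rfl : a = b := by omega
  obtain ⟨n, hn⟩ := Nat.exists_eq_add_of_le (Nat.le_mul_of_pos_right a hc.1.length_pos)
  have h₁ : z.1.1.drop (a * c.length) = δ.drop (a * c.length) := by
    rw [hn, ← drop_drop, hab, drop_drop]
  rw [hc.1.drop_mul_length hzc, hc.1.drop_mul_length hδc] at h₁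
  rw [← hzv, h₁]

end Exclusive

end DirGraph

/-! ### Comparison with the Chen modules -/

theorem isAlgebraic_laurentRoot {K : Type*} [Field K] {f : LaurentPolynomial K} (hf : f ≠ 0) :
    IsAlgebraic K (laurentRoot f : LaurentQuot f) := by
  -- A power of `x` turns `f` into an ordinary polynomial `p`, which is nonzero and vanishes at the
  -- class of `x`.
  obtain ⟨n, p, hp⟩ := LaurentPolynomial.exists_T_pow f
  refine ⟨p, ?_, ?_⟩
  · rintro rfl
    rw [map_zero] at hp
    exact hf ((LaurentPolynomial.isUnit_T n).mul_left_eq_zero.mp hp.symm)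
  · have h₁ : ∀ q : Polynomial K, Polynomial.aeval (LaurentPolynomial.T 1) q =
        Polynomial.toLaurent q := by
      intro q
      have := Polynomial.aeval_algHom_apply (Polynomial.toLaurentAlg (R := K)) Polynomial.X q
      rw [Polynomial.aeval_X_left_apply] at this
      simpa using this
    have h₂ := Polynomial.aeval_algHom_apply (Ideal.Quotient.mkₐ K (Ideal.span {f}))
      (LaurentPolynomial.T 1) p
    rw [h₁, hp] at h₂
    refine h₂.trans ?_
    rw [Ideal.Quotient.mkₐ_eq_mk, Ideal.Quotient.eq_zero_iff_mem]
    exact Ideal.mul_mem_right _ _ (Ideal.mem_span_singleton_self f)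

namespace DirGraph

variable {K V E : Type*} [Field K] {G : DirGraph V E}

open BranchingSystem InfPath

theorem prod_map_take_mul {A : Type*} [CommMonoid A] (wt : E → A) {γ : G.InfPath} {n : ℕ}
    (h : γ.drop n = γ) (i : ℕ) :
    ((γ.take (i * n)).map wt).prod = ((γ.take n).map wt).prod ^ i := by
  induction i with
  | zero => simp [take_zero]
  | succ i ih =>
    rw [Nat.succ_mul, Nat.add_comm, take_add, h, List.map_append, List.prod_append, ih, pow_succ']

variable {c : List E} {v : V} (hc : G.IsExclusive c) (hv : v ∈ G.cycleVerts c)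

theorem InfPath.TailEquiv.drop {α β : G.InfPath} (h : α.TailEquiv β) (n : ℕ) : α.TailEquiv (β.drop n) := by
  induction n with
  | zero => rwa [drop_zero]
  | succ n ih =>
    rw [← drop_drop, drop_one]
    exact ih.tail

/-- The linear combination of powers of the cycle at the source of `γ` with the coefficients of
the polynomial `p`, where `n` is the length of the cycle. -/
noncomputable def cyclePoly (K : Type*) [Field K] (γ : G.InfPath) (n : ℕ) (p : Polynomial K) :
    LPA K G :=
  ∑ i ∈ p.support, p.coeff i • LPA.path K G γ.src (γ.take (i * n))

/-- The powers of the cycle send `γ` with lag `0` to `γ` with the pairwise different lags `i|c|`,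
which are distinct basis elements. -/
theorem cyclePoly_notMem_ann (hc : G.IsCycle c) {γ : G.InfPath} (hγ : ∀ n, γ.edge n ∈ c)
    {p : Polynomial K} (hp : p ≠ 0) :
    cyclePoly K γ c.length p ∉ LeftModule.ann ((lagSystem γ).module K) := by
  intro h
  let z : ℕ → LagPath γ := fun i => ⟨(γ, (i * c.length : ℕ)), i * c.length, 0, by simp, by
    rw [hc.drop_mul_length hγ, drop_zero]⟩
  have hz : Function.Injective z := by
    intro i j hij
    have : ((i * c.length : ℕ) : ℤ) = (j * c.length : ℕ) := congrArg (fun y => y.1.2) hij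
    exact Nat.eq_of_mul_eq_mul_right hc.length_pos (by exact_mod_cast this)
  have htail : ∀ i, LagPath.tail^[i * c.length] (z i) = LagPath.base γ := by
    intro i
    refine Subtype.ext (Prod.ext ?_ ?_)
    · exact ((lagSystem_hasItineraries γ).π_iterate _ _).trans (hc.drop_mul_length hγ i)
    · rw [LagPath.tail_iterate_snd]
      exact sub_self _
  have hact : (lagSystem γ).module K (cyclePoly K γ c.length p)
      (Finsupp.single (LagPath.base γ) 1) = ∑ i ∈ p.support, Finsupp.single (z i) (p.coeff i) := by
    rw [cyclePoly, LeftModule.sum_apply]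
    refine Finset.sum_congr rfl fun i _ => ?_
    have := lagSystem_path_apply (K := K) (z i) (i * c.length) 1
    rw [htail] at this
    rw [module_smul, this, Finsupp.smul_single, smul_eq_mul, mul_one]
  rw [LeftModule.mem_ann_iff.mp h] at hact
  obtain ⟨i, hi⟩ := Polynomial.support_nonempty.mpr hp
  have := DFunLike.congr_fun hact (z i)
  rw [Finsupp.finsetSum_apply, Finset.sum_eq_single_of_mem i hi, Finsupp.single_eq_same] at this
  · exact Polynomial.mem_support_iff.mp hi this.symm
  · intro j _ hj
    exact Finsupp.single_eq_of_ne fun h => hj (hz h).symm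

/-- Arbitrary algebraic weights treat the untwisted and the twisted modules together. If the
annihilators agreed, the cycle would act on the part at `v` by the product of its weights, which is
algebraic, and a polynomial vanishing at this product would give an element of one annihilator but
not of the other. -/
theorem ann_exclusiveModule_ne_twisted {A : Type*} [CommRing A] [Algebra K A] [Nontrivial A]
    (α : G.InfPath) {wt : E → Aˣ} (hwt : ∀ e, IsAlgebraic K (wt e : A)) :
    LeftModule.ann (exclusiveModule K hc hv) ≠
      LeftModule.ann ((infPathSystem α).twistedModule wt K) := by
  intro h
  have hα := infPathSystem_hasItineraries α
  have hroot : ∀ w, w ∈ G.root (G.cycleVerts c) ↔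
      ∃ β : {β : G.InfPath // α.TailEquiv β}, β.1.src = w := by
    intro w
    rw [← not_iff_not, ← vert_mem_ann_exclusiveModule (K := K) hc hv, h, hα.vert_mem_ann_iff,
      not_exists]
  obtain ⟨γ, rfl, hγ⟩ := hc.1.exists_infPath hv
  -- Every vertex of `β` is the source of a tail of `β`, hence lies in the root of `c`; so `β` can
  -- never leave the exclusive cycle.
  have hβ : ∀ β : {β : G.InfPath // α.TailEquiv β}, β.1.src = γ.src → β.1 = γ := by
    intro β hβ
    refine hc.1.infPath_eq (hc.infPath_mem (hβ ▸ hv) fun n => ?_) hγ hβ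
    exact (hroot _).mpr ⟨⟨β.1.drop n, β.2.drop n⟩, rfl⟩
  have halg : IsAlgebraic K ((((γ.take c.length).map wt).prod : Aˣ) : A) := by
    induction γ.take c.length with
    | nil => simpa using isAlgebraic_one
    | cons e l ih =>
      rw [List.map_cons, List.prod_cons, Units.val_mul]
      exact (hwt e).mul ih
  obtain ⟨p, hp₀, hp⟩ := halg
  refine cyclePoly_notMem_ann hc.1 hγ hp₀ ?_
  rw [← ann_exclusiveModule_eq hc hv rfl hγ, h, twistedModule_ann_iff]
  intro β
  rw [cyclePoly, LeftModule.sum_apply]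
  by_cases hsrc : β.1.src = γ.src
  · have hβγ := hβ β hsrc
    have key : ∀ i, (infPathSystem α).twistedModule wt K
        (LPA.path K G γ.src (γ.take (i * c.length))) (Finsupp.single β 1) =
        Finsupp.single β (((((γ.take c.length).map wt).prod : Aˣ) : A) ^ i) := by
      intro i
      have hact := hα.path_apply (K := K) (wt := wt) β (i * c.length) 1
      have hit : (fun β : {β : G.InfPath // α.TailEquiv β} =>
          (⟨β.1.tail, β.2.tail⟩ : {β : G.InfPath // α.TailEquiv β}))^[i * c.length] β = β := by
        refine Subtype.ext ((hα.π_iterate (i * c.length) β).trans ?_)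
        rw [hβγ, hc.1.drop_mul_length hγ]
      rw [hit, hβγ, prod_map_take_mul _ (hc.1.drop_length hγ), one_mul, Units.val_pow_eq_pow_val]
        at hact
      exact hact
    simp only [twistedModule_smul, key, Finsupp.smul_single]
    rw [Polynomial.aeval_def, Polynomial.eval₂_eq_sum, Polynomial.sum_def] at hp
    simp only [← Algebra.smul_def] at hp
    rw [← Finsupp.single_finsetSum, hp, Finsupp.single_zero]
  · refine Finset.sum_eq_zero fun i _ => ?_
    have hp' := γ.isPath_take (i * c.length)
    rw [hc.1.drop_mul_length hγ] at hp'
    rw [twistedModule_smul, ← LPA.path_mul_vert hp', LeftModule.mul_apply,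
      hα.vert_apply_ne hsrc, map_zero, smul_zero]

theorem ann_exclusiveModule_ne_chenInfPath (α : G.InfPath) :
    LeftModule.ann (exclusiveModule K hc hv) ≠ LeftModule.ann (chenInfPath K α) :=
  ann_exclusiveModule_ne_twisted hc hv α fun _ => by simpa using isAlgebraic_one

theorem ann_exclusiveModule_ne_chenTwisted (α : G.InfPath) (d : List E) {f : LaurentPolynomial K}
    (hf : Irreducible f) :
    LeftModule.ann (exclusiveModule K hc hv) ≠ LeftModule.ann (chenTwisted α d f) := by
  have : Nontrivial (LaurentQuot f) := Ideal.Quotient.nontrivial_iff.mpr fun h =>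
    hf.not_isUnit (Ideal.span_singleton_eq_top.mp h)
  refine ann_exclusiveModule_ne_twisted hc hv α fun e => ?_
  split_ifs
  · exact isAlgebraic_laurentRoot hf.ne_zero
  · simpa using isAlgebraic_one

/-- If the annihilators agreed, `u` would be in the root of `c`. If `u` is not on `c`, no path leads
from `v` to `u`, so `v` annihilates only `N_u`. If it is, let `e` be the edge of `c` at `u`: all
infinite paths from `u` in the system begin with `e`, whereas the trivial path at `u` has no first
edge. -/
theorem ann_exclusiveModule_ne_chenVertex (u : V) (hu : G.IsSink u ∨ G.IsInfiniteEmitter u) :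
    LeftModule.ann (exclusiveModule K hc hv) ≠ LeftModule.ann (chenVertex K G u hu) := by
  intro h
  let x₀ : {p : V × List E // G.IsPath p.1 p.2 u} := ⟨(u, []), rfl⟩
  have hx₀ : x₀ ∈ (endingSystem u hu).vset u := rfl
  have hvert : ∀ w m, chenVertex K G u hu (LPA.vert K G w) m =
      (endingSystem u hu).genAction (fun _ => (1 : Kˣ)) (.vert w) m := fun w m =>
    twistedModule_gen _ _ (.vert w) m
  have hghost : ∀ e m, chenVertex K G u hu (LPA.ghost K G e) m =
      (endingSystem u hu).genAction (fun _ => (1 : Kˣ)) (.ghost e) m := fun e m =>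
    twistedModule_gen _ _ (.ghost e) m
  have hx₀u : chenVertex K G u hu (LPA.vert K G u) (Finsupp.single x₀ 1) =
      Finsupp.single x₀ 1 := by
    rw [hvert, genAction_vert_of_mem _ _ hx₀]
  have huroot : u ∈ G.root (G.cycleVerts c) := by
    by_contra hcon
    rw [← vert_mem_ann_exclusiveModule (K := K) hc hv, h, LeftModule.mem_ann_iff] at hcon
    exact one_ne_zero (Finsupp.single_eq_zero.mp (hx₀u.symm.trans (hcon _)))
  have hucyc : u ∈ G.cycleVerts c := by
    by_contra hcon
    refine (vert_mem_ann_exclusiveModule (K := K) hc hv (w := v)).mp ?_ (cycleVerts_subset_root hv)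
    rw [h]
    refine twistedModule_ann_iff.mpr fun p => (hvert v _).trans ?_
    refine genAction_vert_of_notMem _ _ (fun hp => hcon ?_) _
    have hp' : p.1.1 = v := hp
    exact hc.mem_cycleVerts hv (hp' ▸ p.2) huroot
  obtain ⟨γ, hγv, hγ⟩ := hc.1.exists_infPath hv
  obtain ⟨e, he, hes⟩ := id hucyc
  have hlag := lagSystem_hasItineraries γ
  have hmem : LPA.vert K G u - LPA.edge K G e * LPA.ghost K G e ∈
      LeftModule.ann (exclusiveModule K hc hv) := by
    rw [ann_exclusiveModule_eq hc hv hγv hγ]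
    refine twistedModule_ann_iff.mpr fun z => ?_
    rw [LeftModule.sub_apply, LeftModule.mul_apply, sub_eq_zero]
    by_cases hz : z.1.1.src = u
    · have hz₀ : z.1.1.edge 0 = e :=
        hc.1.edge_eq (hc.lagPath_eq hγ z (hz ▸ hucyc) 0) he (hz.trans hes.symm)
      rw [hlag.vert_apply hz, hlag.ghost_apply hz₀, hlag.edge_apply hz₀]
      simp
    · rw [hlag.vert_apply_ne hz, hlag.ghost_apply_ne, map_zero]
      rintro rfl
      exact hz hes
  rw [h, LeftModule.mem_ann_iff] at hmem
  have := hmem (Finsupp.single x₀ 1)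
  rw [LeftModule.sub_apply, LeftModule.mul_apply, hx₀u, hghost,
    genAction_ghost_of_notMem, map_zero, sub_zero] at this
  · exact one_ne_zero (Finsupp.single_eq_zero.mp this)
  · intro hcon
    have : ([] : List E).head? = some e := hcon
    simp at this

end DirGraph

theorem mainTheorem3 {K V E : Type*} [Field K] (G : DirGraph V E)
    (c : List E) (hc : G.IsExclusive c) (v : V) (hv : v ∈ G.cycleVerts c)
    (H : Set V) (hH : H = (G.root (G.cycleVerts c))ᶜ) :
    -- (1) the annihilator
    LeftModule.ann (exclusiveModule K hc hv) = LPA.idealOf K G H (G.breaking H) ∧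
    -- (2) graded simple and not simple
    (LeftModule.IsGraded (LPA.grading K G) (exclusiveModule K hc hv) (exclusiveGrading K G c v) ∧
      LeftModule.IsGradedSimple (exclusiveModule K hc hv) (exclusiveGrading K G c v) ∧
      ¬ LeftModule.IsSimple (exclusiveModule K hc hv)) ∧
    -- (3) change of the vertex
    (∀ (w : V) (hw : w ∈ G.cycleVerts c) (l : List E), G.IsPath v l w → (∀ e ∈ l, e ∈ c) →
      LeftModule.GradedIsomorphic
        (exclusiveModule K hc hv) (exclusiveGrading K G c v)
        (exclusiveModule K hc hw) (LeftModule.shift (exclusiveGrading K G c w) l.length)) ∧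
    -- (4) graded and ungraded isomorphism classes
    (∀ (d : List E) (hd : G.IsExclusive d) (w : V) (hw : w ∈ G.cycleVerts d),
      (LeftModule.GradedIsomorphic
          (exclusiveModule K hc hv) (exclusiveGrading K G c v)
          (exclusiveModule K hd hw) (exclusiveGrading K G d w) ↔ c ~r d ∧ v = w) ∧
      (LeftModule.Isomorphic (exclusiveModule K hc hv) (exclusiveModule K hd hw) ↔ c ~r d)) ∧
    -- (5) comparison with the Chen modules: of infinite paths, twisted, of sinks and infinite emitters
    (∀ α : G.InfPath,
      ¬ LeftModule.Isomorphic (exclusiveModule K hc hv) (chenInfPath K α) ∧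
      LeftModule.ann (exclusiveModule K hc hv) ≠ LeftModule.ann (chenInfPath K α)) ∧
    (∀ (α : G.InfPath) (d : List E) (f : LaurentPolynomial K), G.IsCycle d →
      α.TailEquivCycle d → Irreducible f →
      ¬ LeftModule.Isomorphic (exclusiveModule K hc hv) (chenTwisted α d f) ∧
      LeftModule.ann (exclusiveModule K hc hv) ≠ LeftModule.ann (chenTwisted α d f)) ∧
    (∀ (u : V) (hu : G.IsSink u ∨ G.IsInfiniteEmitter u),
      ¬ LeftModule.Isomorphic (exclusiveModule K hc hv) (chenVertex K G u hu) ∧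
      LeftModule.ann (exclusiveModule K hc hv) ≠ LeftModule.ann (chenVertex K G u hu)) := by
  refine ⟨DirGraph.ann_exclusiveModule hc hv hH,
    ⟨DirGraph.exclusiveModule_isGraded hc hv, DirGraph.exclusiveModule_isGradedSimple hc hv,
      DirGraph.exclusiveModule_not_isSimple hc hv⟩,
    fun w hw l hl hlc => DirGraph.exclusiveModule_gradedIsomorphic_shift hc hv hw hl hlc,
    fun d hd w hw => ⟨⟨fun h => ?_, ?_⟩, fun h => ?_, fun h => ?_⟩,
    fun α => ?_, fun α d f _ _ hf => ?_, fun u hu => ?_⟩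
  · have hcd := DirGraph.isRotated_of_ann_eq hc hv hd hw h.isomorphic.ann_eq
    exact ⟨hcd, DirGraph.eq_of_gradedIsomorphic hc hv hd hw hcd h⟩
  · rintro ⟨hcd, rfl⟩
    exact DirGraph.exclusiveModule_gradedIsomorphic_of_isRotated hc hv hd hw hcd
  · exact DirGraph.isRotated_of_ann_eq hc hv hd hw h.ann_eq
  · exact DirGraph.exclusiveModule_isomorphic_of_isRotated hc hv hd hw h
  · have h := DirGraph.ann_exclusiveModule_ne_chenInfPath (K := K) hc hv α
    exact ⟨fun h' => h h'.ann_eq, h⟩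
  · have h := DirGraph.ann_exclusiveModule_ne_chenTwisted hc hv α d hf
    exact ⟨fun h' => h h'.ann_eq, h⟩
  · have h := DirGraph.ann_exclusiveModule_ne_chenVertex (K := K) hc hv u hu
    exact ⟨fun h' => h h'.ann_eq, h⟩
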